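/- Let $\Psi\in\mathbb{R}^{d\times K}$ be a dictionary whose columns (atoms) $\psi_1,\dots,\psi_K$ have Euclidean norm $1$, with Babel function $$\mu_1(k)=\max_{|\Lambda|=k,\ j\notin\Lambda}\ \sum_{i\in\Lambda}|\langle\psi_i,\psi_j\rangle| ,$$ where the maximum over an empty set is $0$. Let $\Lambda\subset\{1,\dots,K\}$ with $|\Lambda|=S\ge 1$, let $x\in\mathbb{R}^K$ vanish outside $\Lambda$, and put $|x_{\min}|=\min_{i\in\Lambda}|x_i|$, $\|x\|_\infty=\max_i|x_i|$ and $y=\Psi x$. Let $A$ be an $n\times d$ random matrix whose entries are either independent normal variables with mean $0$ and variance $1/n$, or independent variables taking the values $\pm1/\sqrt n$ with probability $1/2$ each. Let $t\in\mathbb{R}$ and $$C_1=\frac{4e}{\sqrt{6\pi}},\qquad C_2=e\sqrt2,\qquad C_3=4C_1+2C_2 .$$ Thresholding, given $S$, $\Phi=A\Psi$ with columns $\varphi_1,\dots,\varphi_K$, and $s\in\mathbb{R}^n$, selects a set $\Lambda'$ of indices of the $S$ largest values of $|\langle s,\varphi_j\rangle|$ and outputs the vector in $\mathbb{R}^K$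 that equals $\Phi_{\Lambda'}^{\dagger}s$ on $\Lambda'$ and $0$ elsewhere, where $\Phi_{\Lambda'}$ is the submatrix of the columns indexed by $\Lambda'$ and $\dagger$ is the Moore--Penrose pseudo-inverse. It recovers $x$ if, however ties are broken, its output for $s=Ay=A\Psi x$ is $x$ (and hence $y$ is recovered as well). Then $C_3\le 17.71$, and: 1. If $\dfrac{|x_{\min}|}{\|x\|_\infty}>\mu_1(S)+\mu_1(S-1)$ and $$n\ \ge\ C_3\,S\,(1+\mu_1(S-1))\,(\log(2K)+t)\left(\frac{|x_{\min}|}{\|x\|_\infty}-\mu_1(S)-\mu_1(S-1)\right)^{-2},$$ then with probability at least $1-e^{-t}$ thresholding recovers $x$ (and hence $y$) from $s=A\Psi x$. 2. If $\Psi$ is an orthonormal basis of $\mathbb{R}^d$ and $x_i\ne0$ for all $i\in\Lambda$, then the condition $|x_{\min}|/\|x\|_\infty>\mu_1(S)+\mu_1(S-1)$ always holds, and thresholding recovers $x$ from $s=A\Psi x$ with probability at least $1-e^{-t}$ as soon as $$n\ >\ C_3\,S\left(\frac{\|x\|_\infty}{|x_{\min}|}\right)^2(\log(2K)+t).$$ 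-/

import Mathlib

open MeasureTheory ProbabilityTheory
open scoped Matrix NNReal ENNReal

namespace Thresholding

/-- A dictionary: a matrix whose columns (the atoms) have Euclidean norm one. -/
def IsDictionary {d K : ℕ} (Ψ : Matrix (Fin d) (Fin K) ℝ) : Prop :=
  ∀ j, ∑ i, Ψ i j ^ 2 = 1

/-- The columns of `Ψ` form an orthonormal basis of `ℝ^d`. -/
def IsOrthonormalBasis {d K : ℕ} (Ψ : Matrix (Fin d) (Fin K) ℝ) : Prop :=
  Ψᵀ * Ψ = 1 ∧ Ψ * Ψᵀ = 1

/-- The Babel function: `μ₁(k)` is the maximum of `∑ i ∈ Λ, |⟨ψ i, ψ j⟩|` over all index sets `Λ`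
with `k` elements and all `j ∉ Λ`. The set below is finite; if it is empty (which happens only for
`k ≥ K`) the value is `0`. -/
noncomputable def babel {d K : ℕ} (Ψ : Matrix (Fin d) (Fin K) ℝ) (k : ℕ) : ℝ :=
  sSup {r : ℝ | ∃ (Λ : Finset (Fin K)) (j : Fin K), Λ.card = k ∧ j ∉ Λ ∧
    r = ∑ i ∈ Λ, |(fun l => Ψ l i) ⬝ᵥ (fun l => Ψ l j)|}

/-- `min_{i ∈ Λ} |x i|`. -/
noncomputable def minAbs {K : ℕ} (Λ : Finset (Fin K)) (hΛ : Λ.Nonempty) (x : Fin K → ℝ) : ℝ :=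
  Λ.inf' hΛ fun i => |x i|

/-- `P` is the Moore-Penrose pseudo-inverse of the real matrix `B` (the four Penrose equations). -/
def IsPseudoInverse {m n : Type*} [Fintype m] [Fintype n]
    (B : Matrix m n ℝ) (P : Matrix n m ℝ) : Prop :=
  B * P * B = B ∧ P * B * P = P ∧ (B * P)ᵀ = B * P ∧ (P * B)ᵀ = P * B

/-- The submatrix of `Φ` consisting of the columns indexed by `Λ`. -/
def columns {n K : ℕ} (Φ : Matrix (Fin n) (Fin K) ℝ) (Λ : Finset (Fin K)) :
    Matrix (Fin n) Λ ℝ :=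
  fun i j => Φ i j

/-- `z` is a possible output of thresholding with sparsity `S`, applied to the measurements `s` and
the matrix `Φ` with columns `φ j`: a set `Λ` of indices of the `S` largest values of `|⟨s, φ j⟩|`
is found (there may be several such sets if there are ties), and the output is
`(columns Φ Λ)^† s`, extended by zero outside `Λ`. -/
def IsOutput {n K : ℕ} (Φ : Matrix (Fin n) (Fin K) ℝ) (S : ℕ) (s : Fin n → ℝ)
    (z : Fin K → ℝ) : Prop :=
  ∃ Λ : Finset (Fin K), Λ.card = S ∧
    (∀ i ∈ Λ, ∀ k ∉ Λ, |s ⬝ᵥ (fun l => Φ l k)| ≤ |s ⬝ᵥ (fun l => Φ l i)|) ∧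
    ∃ P : Matrix Λ (Fin n) ℝ, IsPseudoInverse (columns Φ Λ) P ∧
      (∀ k : Λ, z k = (P *ᵥ s) k) ∧ ∀ k ∉ Λ, z k = 0

/-- Thresholding with the measurement matrix `A` recovers the coefficient vector `x` and the signal
`y = Ψ x` from `s = A y`: whatever way ties are broken, the output exists, is `x`, and
reproduces `y`. -/
def Recovers {n d K : ℕ} (A : Matrix (Fin n) (Fin d) ℝ) (Ψ : Matrix (Fin d) (Fin K) ℝ) (S : ℕ)
    (x : Fin K → ℝ) : Prop :=
  (∀ z, IsOutput (A * Ψ) S (A *ᵥ (Ψ *ᵥ x)) z ↔ z = x) ∧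
    ∀ z, IsOutput (A * Ψ) S (A *ᵥ (Ψ *ᵥ x)) z → Ψ *ᵥ z = Ψ *ᵥ x

/-- The entries of the random `n × d` matrix `A` are independent, normally distributed with mean
zero and variance `1 / n`. -/
def IsGaussianEnsemble {Ω : Type*} [MeasurableSpace Ω] (P : Measure Ω) {n d : ℕ}
    (A : Ω → Matrix (Fin n) (Fin d) ℝ) : Prop :=
  iIndepFun (fun (p : Fin n × Fin d) ω => A ω p.1 p.2) P ∧
    ∀ i j, HasLaw (fun ω => A ω i j) (gaussianReal 0 ((n : ℝ≥0)⁻¹)) P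

/-- The entries of the random `n × d` matrix `A` are independent and take each of the two values
`1 / √n` and `-1 / √n` with probability `1 / 2`. -/
def IsBernoulliEnsemble {Ω : Type*} [MeasurableSpace Ω] (P : Measure Ω) {n d : ℕ}
    (A : Ω → Matrix (Fin n) (Fin d) ℝ) : Prop :=
  iIndepFun (fun (p : Fin n × Fin d) ω => A ω p.1 p.2) P ∧
    ∀ i j, HasLaw (fun ω => A ω i j)
      ((2⁻¹ : ℝ≥0∞) • Measure.dirac (1 / √(n : ℝ)) +
        (2⁻¹ : ℝ≥0∞) • Measure.dirac (-(1 / √(n : ℝ)))) P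

/-- `C₁ = 4e / √(6π)`. -/
noncomputable def C₁ : ℝ := 4 * Real.exp 1 / √(6 * Real.pi)

/-- `C₂ = e √2`. -/
noncomputable def C₂ : ℝ := Real.exp 1 * √2

/-- `C₃ = 4 C₁ + 2 C₂`. -/
noncomputable def C₃ : ℝ := 4 * C₁ + 2 * C₂

end Thresholding

/-!
Write `μ₁` for the Babel function, `S = |Λ|`, `m = μ₁(S - 1)`, `b = μ₁(S)`, `y = Ψ x` and
`L = log (2 K) + t`, where `t > 0` since there is nothing to prove otherwise. Thresholding can fail
only if for some `i ∈ Λ`, `k ∉ Λ` and some sign the inner product of `A y` with `A w` is not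
positive, where `w = sign ⟨y, ψ i⟩ ψ i ± ψ k`, or if `A` is not injective on the span of the atoms
in `Λ` (`recovers_of_separated`, `recovers_of_notMem_exceptionalSet`). The second possibility
matters because a rank-deficient submatrix can make the pseudo-inverse return another vector than `x`.

Before the random matrix is applied, `⟨y, w⟩ ≥ |x_min| - ‖x‖∞ (m + b)`, `‖y‖² ≤ ‖x‖∞² S (1 + m)`
and `‖w‖² ≤ 2 + 2 μ₁(1)`, by the definition of the Babel function.

After multiplication by `√n` the entries of `A` are independent with a law `ν` that has variance
one, vanishing odd moments, and even moments at most those of a standard normal variable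
(`HasDominatedMoments`); no other property of the two ensembles is used. A row `g` then satisfies
`E ⟨g, u⟩ ^ (2 k) ≤ (2 k - 1)!! ‖u‖ ^ (2 k)`, and `X = ⟨g, u⟩ ⟨g, v⟩` has mean `⟨u, v⟩` and second
moment at most `‖u‖² ‖v‖² + 2 ⟨u, v⟩²`. For `u`, `v` in the unit ball with `0 < ⟨u, v⟩ = r ≤ 1 / 2`, the
Taylor expansion of `E exp (-s X)` at `s = 0.44 r`, exact to order two and with `|X|` replaced by
`max (⟨g, u + v⟩²) (⟨g, u - v⟩²) / 4` in the remainder, gives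
`E exp (-s X) ≤ exp (-0.339 r² / (1 + r))` (`integral_exp_neg_mul_le`). Chernoff's bound over the
`n` rows (`measure_sum_mul_nonpos_le`) and the lower bound for `n` show that each comparison fails
with probability at most `exp (-L)` if `S = 1`, and at most `exp (-2 L)` if `2 ≤ S < K`.

For the injectivity, the rows are added one at a time. While the rows used so far have a common zero
`w ≠ 0` in the span, the next row satisfies `⟨g, w⟩ ≠ 0` with probability at least `1 / 3`, by a
Paley-Zygmund argument, and then the dimension of the set of common zeros drops. Hence injectivity
fails with probability at most `3 ^ S (7 / 9) ^ n ≤ exp (-L)` (`measure_kernelMeets_le`).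

There are `2 S (K - S)` comparisons, and the probabilities add up to at most
`exp (-t)` (`failure_estimate`). The case of an orthonormal basis follows because its Babel function
vanishes.
-/


namespace Thresholding

/-! ### Moments of sums of independent variables -/

/-- The `2 k`-th moment `(2 k - 1)!!` of a standard normal variable, written as
`(2 k)! / (2 ^ k k!)`. -/
noncomputable def normalMoment (k : ℕ) : ℝ :=
  (2 * k).factorial / (2 ^ k * k.factorial)

/-- The measure `ν` on `ℝ` has variance one, vanishing odd moments, and even moments not exceeding
those of the standard normal law. -/
structure HasDominatedMoments (ν : Measure ℝ) : Prop where
  integrable_pow : ∀ k : ℕ, Integrable (fun x => x ^ k) ν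
  integral_odd : ∀ k : ℕ, ∫ x, x ^ (2 * k + 1) ∂ν = 0
  integral_sq : ∫ x, x ^ 2 ∂ν = 1
  integral_even_le : ∀ k : ℕ, ∫ x, x ^ (2 * k) ∂ν ≤ normalMoment k

lemma normalMoment_nonneg (k : ℕ) : 0 ≤ normalMoment k := by
  unfold normalMoment; positivity

lemma normalMoment_two : normalMoment 2 = 3 := by
  norm_num [normalMoment, Nat.factorial]

lemma choose_mul_normalMoment {k j : ℕ} (h : j ≤ k) :
    ((2 * k).choose (2 * j) : ℝ) * (normalMoment j * normalMoment (k - j)) =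
      normalMoment k * k.choose j := by
  obtain ⟨i, rfl⟩ := Nat.exists_eq_add_of_le h
  have e : 2 * (j + i) = 2 * j + 2 * i := by ring
  rw [Nat.add_sub_cancel_left, Nat.cast_choose ℝ (by omega), Nat.cast_choose ℝ h, e,
    Nat.add_sub_cancel_left, Nat.add_sub_cancel_left]
  unfold normalMoment
  rw [e]
  field_simp
  ring

lemma sum_range_eq_sum_even {f : ℕ → ℝ} (hf : ∀ j, f (2 * j + 1) = 0) (k : ℕ) :
    ∑ i ∈ Finset.range (2 * k + 1), f i = ∑ j ∈ Finset.range (k + 1), f (2 * j) := by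
  induction k with
  | zero => simp
  | succ k ih =>
    rw [Finset.sum_range_succ _ (k + 1), ← ih, show 2 * (k + 1) + 1 = 2 * k + 1 + 1 + 1 by ring,
      Finset.sum_range_succ, Finset.sum_range_succ, hf]
    simp [mul_add]

section Pi

variable {ν : Measure ℝ} [IsProbabilityMeasure ν]

/-- The splitting of a vector of `m + 1` independent entries into the first one and the others. -/
lemma measurePreserving_cons {α : Type*} [MeasurableSpace α] (μ : Measure α) [SigmaFinite μ]
    (m : ℕ) :
    MeasurePreserving (fun p : α × (Fin m → α) => (Fin.cons p.1 p.2 : Fin (m + 1) → α))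
      (μ.prod (Measure.pi fun _ => μ)) (Measure.pi fun _ => μ) := by
  have h := (measurePreserving_piFinSuccAbove (fun _ : Fin (m + 1) => μ) 0).symm
  convert! h using 1
  funext p
  exact (Fin.insertNth_zero' p.1 p.2).symm

lemma measurableEmbedding_cons {α : Type*} [MeasurableSpace α] (m : ℕ) :
    MeasurableEmbedding
      (fun p : α × (Fin m → α) => (Fin.cons p.1 p.2 : Fin (m + 1) → α)) := by
  convert! (MeasurableEquiv.piFinSuccAbove (fun _ : Fin (m + 1) => α) 0).symm.measurableEmbedding
    using 1
  funext p
  exact (Fin.insertNth_zero' p.1 p.2).symm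

lemma integral_pi_succ {d : ℕ} {f : (Fin (d + 1) → ℝ) → ℝ} :
    ∫ g, f g ∂(Measure.pi fun _ => ν) =
      ∫ p : ℝ × (Fin d → ℝ), f (Fin.cons p.1 p.2) ∂(ν.prod (Measure.pi fun _ => ν)) :=
  ((measurePreserving_cons ν d).integral_comp (measurableEmbedding_cons d) f).symm

lemma integrable_pi_succ {d : ℕ} {f : (Fin (d + 1) → ℝ) → ℝ} :
    Integrable f (Measure.pi fun _ => ν) ↔
      Integrable (fun p : ℝ × (Fin d → ℝ) => f (Fin.cons p.1 p.2))
        (ν.prod (Measure.pi fun _ => ν)) :=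
  ((measurePreserving_cons ν d).integrable_comp_emb (measurableEmbedding_cons d)).symm

lemma cons_dotProduct {d : ℕ} (a : ℝ) (g : Fin d → ℝ) (u : Fin (d + 1) → ℝ) :
    (Fin.cons a g : Fin (d + 1) → ℝ) ⬝ᵥ u = a * u 0 + g ⬝ᵥ (fun j => u j.succ) := by
  simp [dotProduct, Fin.sum_univ_succ]

lemma dotProduct_succ {d : ℕ} (u v : Fin (d + 1) → ℝ) :
    u ⬝ᵥ v = u 0 * v 0 + (fun j => u j.succ) ⬝ᵥ (fun j : Fin d => v j.succ) := by
  simp [dotProduct, Fin.sum_univ_succ]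

/-- Moments of `⟨g, u⟩` for a vector `g` of independent coordinates with law `ν`: the binomial
expansion of the first coordinate against the others. -/
lemma integral_dotProduct_pow_succ (hν : HasDominatedMoments ν) {d : ℕ}
    (u : Fin (d + 1) → ℝ) (k : ℕ)
    (h : ∀ k : ℕ, Integrable (fun g : Fin d → ℝ => (g ⬝ᵥ (fun j => u j.succ)) ^ k)
      (Measure.pi fun _ => ν)) :
    Integrable (fun g => (g ⬝ᵥ u) ^ k) (Measure.pi fun _ => ν) ∧
    ∫ g, (g ⬝ᵥ u) ^ k ∂(Measure.pi fun _ => ν) =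
      ∑ i ∈ Finset.range (k + 1), k.choose i * (u 0 ^ i * (∫ x, x ^ i ∂ν) *
        ∫ g : Fin d → ℝ, (g ⬝ᵥ (fun j => u j.succ)) ^ (k - i) ∂(Measure.pi fun _ => ν)) := by
  have e : ∀ p : ℝ × (Fin d → ℝ), ((Fin.cons p.1 p.2 : Fin (d + 1) → ℝ) ⬝ᵥ u) ^ k =
      ∑ i ∈ Finset.range (k + 1), (k.choose i * u 0 ^ i) *
        (p.1 ^ i * (p.2 ⬝ᵥ (fun j => u j.succ)) ^ (k - i)) := by
    intro p
    rw [cons_dotProduct, add_pow]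
    refine Finset.sum_congr rfl fun i _ => ?_
    ring
  have hi : ∀ i ∈ Finset.range (k + 1), Integrable (fun p : ℝ × (Fin d → ℝ) =>
      (k.choose i * u 0 ^ i) * (p.1 ^ i * (p.2 ⬝ᵥ (fun j => u j.succ)) ^ (k - i)))
      (ν.prod (Measure.pi fun _ => ν)) :=
    fun i _ => ((hν.integrable_pow i).mul_prod (h (k - i))).const_mul _
  constructor
  · rw [integrable_pi_succ]
    simp_rw [e]
    exact integrable_finsetSum _ hi
  · rw [integral_pi_succ]
    simp_rw [e]
    rw [integral_finsetSum _ hi]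
    refine Finset.sum_congr rfl fun i _ => ?_
    rw [integral_const_mul, integral_prod_mul (fun x => x ^ i)
      (fun g : Fin d → ℝ => (g ⬝ᵥ (fun j => u j.succ)) ^ (k - i))]
    ring

lemma integrable_dotProduct_pow (hν : HasDominatedMoments ν) {d : ℕ} (u : Fin d → ℝ) (k : ℕ) :
    Integrable (fun g => (g ⬝ᵥ u) ^ k) (Measure.pi fun _ => ν) := by
  induction d generalizing k with
  | zero => simp
  | succ d ih => exact (integral_dotProduct_pow_succ hν u k fun k => ih _ k).1

lemma integral_dotProduct_sq (hν : HasDominatedMoments ν) {d : ℕ} (u : Fin d → ℝ) :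
    ∫ g, (g ⬝ᵥ u) ^ 2 ∂(Measure.pi fun _ => ν) = u ⬝ᵥ u := by
  induction d with
  | zero => simp
  | succ d ih =>
    rw [(integral_dotProduct_pow_succ hν u _ fun k => integrable_dotProduct_pow hν _ k).2]
    have h1 := hν.integral_odd 0
    simp only [mul_zero, zero_add, pow_one] at h1
    simp [Finset.sum_range_succ, ih, h1, hν.integral_sq, dotProduct_succ u u]
    ring

/-- The moments of `⟨g, u⟩` do not exceed those of a normal variable of variance `‖u‖²`
(a Khintchine inequality with the optimal constants). -/
lemma integral_dotProduct_pow_even_le (hν : HasDominatedMoments ν) {d : ℕ} (u : Fin d → ℝ)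
    (k : ℕ) :
    ∫ g, (g ⬝ᵥ u) ^ (2 * k) ∂(Measure.pi fun _ => ν) ≤ normalMoment k * (u ⬝ᵥ u) ^ k := by
  induction d generalizing k with
  | zero =>
    rcases k.eq_zero_or_pos with rfl | hk
    · simp [normalMoment]
    · simp [hk.ne', zero_pow]
  | succ d ih =>
    rw [(integral_dotProduct_pow_succ hν u _ fun k => integrable_dotProduct_pow hν _ k).2,
      sum_range_eq_sum_even, dotProduct_succ u u, add_pow, Finset.mul_sum]
    · refine Finset.sum_le_sum fun j hj => ?_
      have hj' : j ≤ k := Nat.lt_succ_iff.1 (Finset.mem_range.1 hj)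
      rw [show 2 * k - 2 * j = 2 * (k - j) by omega]
      set v : Fin d → ℝ := fun j => u j.succ
      have h1 := ih v (k - j)
      have h2 := hν.integral_even_le j
      have h3 : 0 ≤ ∫ x, x ^ (2 * j) ∂ν :=
        integral_nonneg fun x => by simpa [pow_mul] using pow_nonneg (sq_nonneg x) j
      have h4 : 0 ≤ ∫ g, (g ⬝ᵥ v) ^ (2 * (k - j)) ∂(Measure.pi fun _ => ν) :=
        integral_nonneg fun x => by simpa [pow_mul] using pow_nonneg (sq_nonneg _) _
      have h5 : 0 ≤ u 0 ^ (2 * j) := by rw [pow_mul]; positivity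
      calc _ ≤ ((2 * k).choose (2 * j) : ℝ) * (u 0 ^ (2 * j) * normalMoment j *
            (normalMoment (k - j) * (v ⬝ᵥ v) ^ (k - j))) := by
            have := normalMoment_nonneg j
            gcongr
        _ = (((2 * k).choose (2 * j) : ℝ) * (normalMoment j * normalMoment (k - j))) *
            (u 0 ^ (2 * j) * (v ⬝ᵥ v) ^ (k - j)) := by ring
        _ = _ := by rw [choose_mul_normalMoment hj']; ring
    · intro j
      rw [hν.integral_odd, mul_zero, zero_mul, mul_zero]

lemma integrable_dotProduct_mul (hν : HasDominatedMoments ν) {d : ℕ} (u v : Fin d → ℝ)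
    (a b : ℕ) :
    Integrable (fun g => (g ⬝ᵥ u) ^ a * (g ⬝ᵥ v) ^ b) (Measure.pi fun _ => ν) := by
  refine ((integrable_dotProduct_pow hν u (2 * a)).add
    (integrable_dotProduct_pow hν v (2 * b))).mono' (by
      apply Measurable.aestronglyMeasurable
      simp only [dotProduct]
      fun_prop) (.of_forall fun g => ?_)
  simp only [Pi.add_apply, Real.norm_eq_abs]
  rw [abs_le, mul_comm 2 a, mul_comm 2 b, pow_mul, pow_mul]
  constructor <;> nlinarith [sq_nonneg ((g ⬝ᵥ u) ^ a + (g ⬝ᵥ v) ^ b),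
    sq_nonneg ((g ⬝ᵥ u) ^ a - (g ⬝ᵥ v) ^ b), sq_nonneg ((g ⬝ᵥ u) ^ a), sq_nonneg ((g ⬝ᵥ v) ^ b)]

lemma integral_dotProduct_mul (hν : HasDominatedMoments ν) {d : ℕ} (u v : Fin d → ℝ) :
    ∫ g, (g ⬝ᵥ u) * (g ⬝ᵥ v) ∂(Measure.pi fun _ => ν) = u ⬝ᵥ v := by
  have e : ∀ g : Fin d → ℝ, (g ⬝ᵥ u) * (g ⬝ᵥ v) =
      1 / 4 * (g ⬝ᵥ (u + v)) ^ 2 - 1 / 4 * (g ⬝ᵥ (u - v)) ^ 2 := by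
    intro g
    rw [dotProduct_add, dotProduct_sub]
    ring
  simp_rw [e]
  rw [integral_sub ((integrable_dotProduct_pow hν _ 2).const_mul _)
    ((integrable_dotProduct_pow hν _ 2).const_mul _), integral_const_mul, integral_const_mul,
    integral_dotProduct_sq hν, integral_dotProduct_sq hν]
  simp only [dotProduct_add, add_dotProduct, dotProduct_sub, sub_dotProduct, dotProduct_comm v u]
  ring

/-- The second moment of `⟨g, u⟩ ⟨g, v⟩` is at most its value for a normal vector `g`. -/
lemma integral_dotProduct_mul_sq_le (hν : HasDominatedMoments ν) {d : ℕ} (u v : Fin d → ℝ) :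
    ∫ g, (g ⬝ᵥ u) ^ 2 * (g ⬝ᵥ v) ^ 2 ∂(Measure.pi fun _ => ν) ≤
      (u ⬝ᵥ u) * (v ⬝ᵥ v) + 2 * (u ⬝ᵥ v) ^ 2 := by
  induction d with
  | zero => simp
  | succ d ih =>
    rw [integral_pi_succ]
    set a := u 0 with ha
    set b := v 0 with hb
    set u' : Fin d → ℝ := fun j => u j.succ with hu'
    set v' : Fin d → ℝ := fun j => v j.succ with hv'
    have hu : u ⬝ᵥ u = a * a + u' ⬝ᵥ u' := dotProduct_succ u u
    have hv : v ⬝ᵥ v = b * b + v' ⬝ᵥ v' := dotProduct_succ v v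
    have huv : u ⬝ᵥ v = a * b + u' ⬝ᵥ v' := dotProduct_succ u v
    -- the integrand, expanded in powers of the first coordinate
    have e : ∀ p : ℝ × (Fin d → ℝ),
        ((Fin.cons p.1 p.2 : Fin (d + 1) → ℝ) ⬝ᵥ u) ^ 2 *
          ((Fin.cons p.1 p.2 : Fin (d + 1) → ℝ) ⬝ᵥ v) ^ 2 =
        (p.1 ^ 4 * (a ^ 2 * b ^ 2)) +
        (p.1 ^ 3 * (2 * a ^ 2 * b * ((p.2 ⬝ᵥ u') ^ 0 * (p.2 ⬝ᵥ v') ^ 1)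
          + 2 * a * b ^ 2 * ((p.2 ⬝ᵥ u') ^ 1 * (p.2 ⬝ᵥ v') ^ 0))) +
        (p.1 ^ 2 * (a ^ 2 * (p.2 ⬝ᵥ v') ^ 2 + b ^ 2 * (p.2 ⬝ᵥ u') ^ 2 +
          4 * a * b * ((p.2 ⬝ᵥ u') * (p.2 ⬝ᵥ v')))) +
        (p.1 ^ 1 * (2 * a * ((p.2 ⬝ᵥ u') ^ 1 * (p.2 ⬝ᵥ v') ^ 2) +
          2 * b * ((p.2 ⬝ᵥ u') ^ 2 * (p.2 ⬝ᵥ v') ^ 1))) +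
        (p.1 ^ 0 * ((p.2 ⬝ᵥ u') ^ 2 * (p.2 ⬝ᵥ v') ^ 2)) := by
      intro p
      rw [cons_dotProduct, cons_dotProduct]
      ring
    simp_rw [e]
    have I := integrable_dotProduct_mul hν u' v'
    have Iuv : Integrable (fun g => (g ⬝ᵥ u') * (g ⬝ᵥ v')) (Measure.pi fun _ => ν) := by
      simpa using I 1 1
    have J := hν.integrable_pow
    have i4 := (J 4).mul_prod (ν := Measure.pi fun _ : Fin d => ν)
      (integrable_const (a ^ 2 * b ^ 2))
    have i3 := (J 3).mul_prod (((I 0 1).const_mul (2 * a ^ 2 * b)).add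
      ((I 1 0).const_mul (2 * a * b ^ 2)))
    have i2 := (J 2).mul_prod ((((integrable_dotProduct_pow hν v' 2).const_mul (a ^ 2)).add
      ((integrable_dotProduct_pow hν u' 2).const_mul (b ^ 2))).add (Iuv.const_mul (4 * a * b)))
    have i1 := (J 1).mul_prod (((I 1 2).const_mul (2 * a)).add ((I 2 1).const_mul (2 * b)))
    have i0 := (J 0).mul_prod (I 2 2)
    simp only [Pi.add_apply] at i4 i3 i2 i1 i0
    rw [integral_add (by exact ((i4.add i3).add i2).add i1) i0,
      integral_add (by exact (i4.add i3).add i2) i1,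
      integral_add (by exact i4.add i3) i2, integral_add i4 i3]
    have o1 := hν.integral_odd 0
    have o3 := hν.integral_odd 1
    norm_num at o1 o3
    have m4 := hν.integral_even_le 2
    rw [normalMoment_two] at m4
    norm_num at m4
    rw [integral_prod_mul (fun x => x ^ 4)
        (fun _ : Fin d → ℝ => a ^ 2 * b ^ 2), integral_prod_mul (fun x => x ^ 3)
        (fun g : Fin d → ℝ => 2 * a ^ 2 * b * ((g ⬝ᵥ u') ^ 0 * (g ⬝ᵥ v') ^ 1) +
          2 * a * b ^ 2 * ((g ⬝ᵥ u') ^ 1 * (g ⬝ᵥ v') ^ 0)),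
      integral_prod_mul (fun x => x ^ 2)
        (fun g : Fin d → ℝ => a ^ 2 * (g ⬝ᵥ v') ^ 2 + b ^ 2 * (g ⬝ᵥ u') ^ 2 +
          4 * a * b * ((g ⬝ᵥ u') * (g ⬝ᵥ v'))), integral_prod_mul (fun x => x ^ 1)
        (fun g : Fin d → ℝ => 2 * a * ((g ⬝ᵥ u') ^ 1 * (g ⬝ᵥ v') ^ 2) +
          2 * b * ((g ⬝ᵥ u') ^ 2 * (g ⬝ᵥ v') ^ 1)),
      integral_prod_mul (fun x => x ^ 0)
        (fun g : Fin d → ℝ => (g ⬝ᵥ u') ^ 2 * (g ⬝ᵥ v') ^ 2), hν.integral_sq]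
    simp only [o3, pow_one, o1, zero_mul, add_zero, one_mul, pow_zero, integral_const,
      probReal_univ, smul_eq_mul]
    have e2 : ∫ g : Fin d → ℝ, (a ^ 2 * (g ⬝ᵥ v') ^ 2 + b ^ 2 * (g ⬝ᵥ u') ^ 2 +
        4 * a * b * ((g ⬝ᵥ u') * (g ⬝ᵥ v'))) ∂(Measure.pi fun _ => ν) =
        a ^ 2 * (v' ⬝ᵥ v') + b ^ 2 * (u' ⬝ᵥ u') + 4 * a * b * (u' ⬝ᵥ v') := by
      have iv := (integrable_dotProduct_pow hν v' 2).const_mul (a ^ 2)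
      have iu := (integrable_dotProduct_pow hν u' 2).const_mul (b ^ 2)
      rw [integral_add (by exact iv.add iu) (Iuv.const_mul (4 * a * b)), integral_add iv iu,
        integral_const_mul, integral_const_mul, integral_const_mul, integral_dotProduct_sq hν,
        integral_dotProduct_sq hν, integral_dotProduct_mul hν]
    rw [e2, hu, hv, huv]
    have := ih u' v'
    nlinarith [mul_le_mul_of_nonneg_right m4 (mul_nonneg (sq_nonneg a) (sq_nonneg b))]

end Pi

/-! ### Exponential moments of a product of two sums -/

/-- The remainder of order three of the exponential series. -/
noncomputable def expRemainder (z : ℝ) : ℝ := Real.exp z - 1 - z - z ^ 2 / 2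

lemma hasSum_expRemainder (z : ℝ) :
    HasSum (fun k : ℕ => z ^ (k + 3) / (k + 3).factorial) (expRemainder z) := by
  have h := NormedSpace.expSeries_div_hasSum_exp z
  rw [← Real.exp_eq_exp_ℝ, ← hasSum_nat_add_iff' 3] at h
  convert! h using 1
  simp [Finset.sum_range_succ, expRemainder]
  ring

lemma expRemainder_le_expRemainder {z w : ℝ} (hz : 0 ≤ z) (h : z ≤ w) :
    expRemainder z ≤ expRemainder w :=
  hasSum_le (fun k => by gcongr) (hasSum_expRemainder z) (hasSum_expRemainder w)

lemma expRemainder_nonneg {z : ℝ} (hz : 0 ≤ z) : 0 ≤ expRemainder z :=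
  (hasSum_expRemainder z).nonneg fun k => by positivity

lemma exp_neg_le (z : ℝ) : Real.exp (-z) ≤ 1 - z + z ^ 2 / 2 + expRemainder |z| := by
  unfold expRemainder
  rcases le_total z 0 with h | h
  · rw [abs_of_nonpos h]
    nlinarith
  · rw [abs_of_nonneg h]
    have := Real.self_le_sinh_iff.2 h
    rw [Real.sinh_eq] at this
    nlinarith

/-- From the third one on, the coefficients of `(1 - x) ^ (-1 / 2)` are at most `5 / 16`. -/
lemma normalMoment_div_le (k : ℕ) :
    normalMoment (k + 3) / ((k + 3).factorial * 2 ^ (k + 3)) ≤ 5 / 16 := by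
  induction k with
  | zero => norm_num [normalMoment, Nat.factorial]
  | succ k ih =>
    refine le_trans ?_ ih
    unfold normalMoment
    rw [show 2 * (k + 1 + 3) = 2 * (k + 3) + 1 + 1 by ring, show k + 1 + 3 = k + 3 + 1 by ring,
      Nat.factorial_succ, Nat.factorial_succ, Nat.factorial_succ]
    have e : ((2 * (k + 3) + 1 + 1 : ℕ) * ((2 * (k + 3) + 1 : ℕ) * (2 * (k + 3)).factorial : ℕ) : ℕ)
        / (2 ^ (k + 3 + 1) * ((k + 3 + 1 : ℕ) * (k + 3).factorial : ℕ)) /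
        (((k + 3 + 1 : ℕ) * (k + 3).factorial : ℕ) * 2 ^ (k + 3 + 1)) =
        ((2 * (k + 3)).factorial / (2 ^ (k + 3) * (k + 3).factorial) /
          ((k + 3).factorial * 2 ^ (k + 3))) * ((2 * k + 7) / (2 * k + 8) : ℝ) := by
      push_cast
      field_simp
      ring
    rw [e]
    refine mul_le_of_le_one_right (by positivity) ?_
    rw [div_le_one (by positivity)]
    linarith

section

variable {ν : Measure ℝ} [IsProbabilityMeasure ν]

lemma measurable_dotProduct_right {d : ℕ} (u : Fin d → ℝ) :
    Measurable (fun g : Fin d → ℝ => g ⬝ᵥ u) := by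
  simp only [dotProduct]
  fun_prop

lemma measurable_expRemainder : Measurable expRemainder := by
  unfold expRemainder
  fun_prop

/-- The expectation of the exponential remainder at `c ⟨g, u⟩²`, bounded term by term by that of a
normal variable. -/
lemma integral_expRemainder_le (hν : HasDominatedMoments ν) {d : ℕ} {u : Fin d → ℝ} {c x : ℝ}
    (hc : 0 ≤ c) (hux : 2 * c * (u ⬝ᵥ u) ≤ x) (hx : x < 1) :
    Integrable (fun g => expRemainder (c * (g ⬝ᵥ u) ^ 2)) (Measure.pi fun _ => ν) ∧
    ∫ g, expRemainder (c * (g ⬝ᵥ u) ^ 2) ∂(Measure.pi fun _ => ν) ≤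
      5 / 16 * x ^ 3 * (1 - x)⁻¹ := by
  set μ : Measure (Fin d → ℝ) := Measure.pi fun _ => ν
  have hu0 : 0 ≤ u ⬝ᵥ u := by
    simpa [dotProduct] using Finset.sum_nonneg fun i _ => mul_self_nonneg (u i)
  have hx0 : 0 ≤ x := le_trans (by positivity) hux
  have hpos : ∀ g : Fin d → ℝ, 0 ≤ c * (g ⬝ᵥ u) ^ 2 := fun g => by positivity
  have hmeas : Measurable (fun g : Fin d → ℝ => c * (g ⬝ᵥ u) ^ 2) :=
    ((measurable_dotProduct_right u).pow_const 2).const_mul c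
  have hterm : ∀ k : ℕ, ∫⁻ g, ENNReal.ofReal ((c * (g ⬝ᵥ u) ^ 2) ^ (k + 3) / (k + 3).factorial) ∂μ
      ≤ ENNReal.ofReal (5 / 16 * x ^ 3 * x ^ k) := by
    intro k
    have e : ∀ g : Fin d → ℝ, (c * (g ⬝ᵥ u) ^ 2) ^ (k + 3) / (k + 3).factorial =
        c ^ (k + 3) / (k + 3).factorial * (g ⬝ᵥ u) ^ (2 * (k + 3)) := by
      intro g
      rw [mul_pow, ← pow_mul]
      ring
    rw [← ofReal_integral_eq_lintegral_ofReal]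
    · apply ENNReal.ofReal_le_ofReal
      simp_rw [e]
      rw [integral_const_mul]
      have h1 := integral_dotProduct_pow_even_le hν u (k + 3)
      calc _ ≤ c ^ (k + 3) / (k + 3).factorial * (normalMoment (k + 3) * (u ⬝ᵥ u) ^ (k + 3)) := by
            gcongr
        _ = normalMoment (k + 3) / ((k + 3).factorial * 2 ^ (k + 3)) *
            (2 * c * (u ⬝ᵥ u)) ^ (k + 3) := by
            rw [mul_pow, mul_pow]
            field_simp
        _ ≤ 5 / 16 * x ^ (k + 3) := by
            have := normalMoment_div_le k
            gcongr
        _ = _ := by ring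
    · simp_rw [e]
      exact (integrable_dotProduct_pow hν u _).const_mul _
    · exact .of_forall fun g => div_nonneg (pow_nonneg (hpos g) _) (by positivity)
  have hgeo : HasSum (fun k : ℕ => 5 / 16 * x ^ 3 * x ^ k) (5 / 16 * x ^ 3 * (1 - x)⁻¹) :=
    (hasSum_geometric_of_lt_one hx0 hx).mul_left _
  have hlin : ∫⁻ g, ENNReal.ofReal (expRemainder (c * (g ⬝ᵥ u) ^ 2)) ∂μ ≤
      ENNReal.ofReal (5 / 16 * x ^ 3 * (1 - x)⁻¹) := by
    have e : ∀ g : Fin d → ℝ, ENNReal.ofReal (expRemainder (c * (g ⬝ᵥ u) ^ 2)) =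
        ∑' k : ℕ, ENNReal.ofReal ((c * (g ⬝ᵥ u) ^ 2) ^ (k + 3) / (k + 3).factorial) := by
      intro g
      rw [← (hasSum_expRemainder _).tsum_eq, ENNReal.ofReal_tsum_of_nonneg
        (fun k => div_nonneg (pow_nonneg (hpos g) _) (by positivity))
        (hasSum_expRemainder _).summable]
    simp_rw [e]
    rw [lintegral_tsum fun k => ((hmeas.pow_const _).div_const _).ennreal_ofReal.aemeasurable,
      ← hgeo.tsum_eq, ENNReal.ofReal_tsum_of_nonneg (fun k => by positivity) hgeo.summable]
    exact ENNReal.tsum_le_tsum hterm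
  have hint : Integrable (fun g => expRemainder (c * (g ⬝ᵥ u) ^ 2)) μ := by
    refine ⟨(measurable_expRemainder.comp hmeas).aestronglyMeasurable, ?_⟩
    rw [hasFiniteIntegral_iff_ofReal (.of_forall fun g => expRemainder_nonneg (hpos g))]
    exact hlin.trans_lt ENNReal.ofReal_lt_top
  refine ⟨hint, ?_⟩
  rw [← ofReal_integral_eq_lintegral_ofReal hint
    (.of_forall fun g => expRemainder_nonneg (hpos g))] at hlin
  exact (ENNReal.ofReal_le_ofReal_iff
    (mul_nonneg (by positivity) (inv_nonneg.2 (by linarith)))).1 hlin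

/-- The numerical inequality behind `integral_exp_neg_mul_le`, with `s = 0.44 r`. To second order in
`r` it reads `0.44 - 0.44 ^ 2 / 2 ≥ 0.339`; a much larger factor than `0.44` would make the remainder
too large at `r = 1 / 2`. -/
lemma exponent_estimate {r : ℝ} (h0 : 0 < r) (h1 : r ≤ 1 / 2) :
    1 - 0.44 * r * r + (0.44 * r) ^ 2 / 2 * (1 + 2 * r ^ 2) +
      (5 / 16 * (0.44 * r * (1 + r)) ^ 3 * (1 - 0.44 * r * (1 + r))⁻¹ +
        5 / 16 * (0.44 * r * (1 - r)) ^ 3 * (1 - 0.44 * r * (1 - r))⁻¹) ≤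
      Real.exp (-(0.339 * r ^ 2 / (1 + r))) := by
  have i1 : (1 - 0.44 * r * (1 + r))⁻¹ ≤ 1.5 := by
    rw [inv_le_comm₀ (by nlinarith) (by norm_num)]
    norm_num
    nlinarith
  have i2 : (1 - 0.44 * r * (1 - r))⁻¹ ≤ 1.5 := by
    rw [inv_le_comm₀ (by nlinarith) (by norm_num)]
    norm_num
    nlinarith
  have t : 5 / 16 * (0.44 * r * (1 + r)) ^ 3 * (1 - 0.44 * r * (1 + r))⁻¹ +
        5 / 16 * (0.44 * r * (1 - r)) ^ 3 * (1 - 0.44 * r * (1 - r))⁻¹ ≤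
      5 / 16 * (0.44 * r * (1 + r)) ^ 3 * 1.5 + 5 / 16 * (0.44 * r * (1 - r)) ^ 3 * 1.5 := by
    have : 0 ≤ 1 - r := by linarith
    gcongr
  set z := 0.339 * r ^ 2 / (1 + r) with hz
  have hzr : z * (1 + r) = 0.339 * r ^ 2 := by
    rw [hz]
    field_simp
  have e : (1 - z / 2) ^ 2 ≤ Real.exp (-z) := by
    have h2 : 0 ≤ 1 - z / 2 := by
      have : 0 ≤ z := by positivity
      nlinarith
    have h3 : 1 - z / 2 ≤ Real.exp (-(z / 2)) := by
      have := Real.add_one_le_exp (-(z / 2))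
      linarith
    calc (1 - z / 2) ^ 2 ≤ Real.exp (-(z / 2)) ^ 2 := by gcongr
      _ = Real.exp (-z) := by rw [← Real.exp_nat_mul]; congr 1; push_cast; ring
  refine le_trans ?_ e
  refine le_trans (add_le_add_right t _) ?_
  have hp : 0 ≤ (0.44 - 0.0968 * (1 + 2 * r ^ 2) - 0.08 * r * (1 + 3 * r ^ 2)) * (1 + r) ^ 2
      - 0.339 * (1 + r) + 0.339 ^ 2 / 4 * r ^ 2 := by
    nlinarith [mul_nonneg h0.le (sub_nonneg.2 h1), mul_nonneg (sq_nonneg r) (sub_nonneg.2 h1),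
      mul_nonneg (pow_nonneg h0.le 3) (sub_nonneg.2 h1),
      mul_nonneg (pow_nonneg h0.le 4) (sub_nonneg.2 h1)]
  have hq : (0.44 - 0.0968 * (1 + 2 * r ^ 2) - 0.08 * r * (1 + 3 * r ^ 2)) * r ^ 2 ≥
      z - z ^ 2 / 4 := by
    have e1 : ((0.44 - 0.0968 * (1 + 2 * r ^ 2) - 0.08 * r * (1 + 3 * r ^ 2)) * r ^ 2 -
        (z - z ^ 2 / 4)) * (1 + r) ^ 2 =
        r ^ 2 * ((0.44 - 0.0968 * (1 + 2 * r ^ 2) - 0.08 * r * (1 + 3 * r ^ 2)) * (1 + r) ^ 2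
      - 0.339 * (1 + r) + 0.339 ^ 2 / 4 * r ^ 2) := by
      linear_combination (-(1 + r) + (z * (1 + r) + 0.339 * r ^ 2) / 4) * hzr
    have e2 : 0 ≤ ((0.44 - 0.0968 * (1 + 2 * r ^ 2) - 0.08 * r * (1 + 3 * r ^ 2)) * r ^ 2 -
        (z - z ^ 2 / 4)) * (1 + r) ^ 2 := by
      rw [e1]; positivity
    have := nonneg_of_mul_nonneg_left e2 (by positivity)
    linarith
  nlinarith [pow_nonneg h0.le 3, pow_nonneg h0.le 5]

/-- The exponential moment of `-⟨g, u⟩ ⟨g, v⟩`. The terms of order one and two are estimated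
exactly; in those of higher order `|⟨g, u⟩ ⟨g, v⟩|` is replaced by
`max (⟨g, u + v⟩² / 4) (⟨g, u - v⟩² / 4)`. -/
lemma integral_exp_neg_mul_le (hν : HasDominatedMoments ν) {d : ℕ} {u v : Fin d → ℝ} {r : ℝ}
    (hu : u ⬝ᵥ u ≤ 1) (hv : v ⬝ᵥ v ≤ 1) (huv : u ⬝ᵥ v = r) (h0 : 0 < r) (h1 : r ≤ 1 / 2) :
    Integrable (fun g => Real.exp (-(0.44 * r * ((g ⬝ᵥ u) * (g ⬝ᵥ v))))) (Measure.pi fun _ => ν) ∧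
    ∫ g, Real.exp (-(0.44 * r * ((g ⬝ᵥ u) * (g ⬝ᵥ v)))) ∂(Measure.pi fun _ => ν) ≤
      Real.exp (-(0.339 * r ^ 2 / (1 + r))) := by
  set s := 0.44 * r with hs
  have hs0 : 0 < s := by positivity
  have hvu : v ⬝ᵥ u = r := by rw [dotProduct_comm, huv]
  obtain ⟨ip, bp⟩ := integral_expRemainder_le hν (u := u + v) (c := s / 4) (x := s * (1 + r))
    (by positivity) (by
      simp only [dotProduct_add, add_dotProduct, hvu, huv]
      nlinarith) (by nlinarith)
  obtain ⟨im, bm⟩ := integral_expRemainder_le hν (u := u - v) (c := s / 4) (x := s * (1 - r))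
    (by positivity) (by
      simp only [dotProduct_sub, sub_dotProduct, hvu, huv]
      nlinarith) (by nlinarith)
  have hpt : ∀ g : Fin d → ℝ, Real.exp (-(s * ((g ⬝ᵥ u) * (g ⬝ᵥ v)))) ≤
      (1 - s * ((g ⬝ᵥ u) * (g ⬝ᵥ v)) + s ^ 2 / 2 * ((g ⬝ᵥ u) ^ 2 * (g ⬝ᵥ v) ^ 2)) +
      (expRemainder (s / 4 * (g ⬝ᵥ (u + v)) ^ 2) + expRemainder (s / 4 * (g ⬝ᵥ (u - v)) ^ 2)) := by
    intro g
    have hP : 0 ≤ s / 4 * (g ⬝ᵥ (u + v)) ^ 2 := by positivity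
    have hM : 0 ≤ s / 4 * (g ⬝ᵥ (u - v)) ^ 2 := by positivity
    have e : s * ((g ⬝ᵥ u) * (g ⬝ᵥ v)) =
        s / 4 * (g ⬝ᵥ (u + v)) ^ 2 - s / 4 * (g ⬝ᵥ (u - v)) ^ 2 := by
      rw [dotProduct_add, dotProduct_sub]
      ring
    have h := exp_neg_le (s * ((g ⬝ᵥ u) * (g ⬝ᵥ v)))
    have hR : expRemainder |s * ((g ⬝ᵥ u) * (g ⬝ᵥ v))| ≤
        expRemainder (s / 4 * (g ⬝ᵥ (u + v)) ^ 2) +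
          expRemainder (s / 4 * (g ⬝ᵥ (u - v)) ^ 2) := by
      rw [e]
      rcases le_total (s / 4 * (g ⬝ᵥ (u - v)) ^ 2) (s / 4 * (g ⬝ᵥ (u + v)) ^ 2) with hle | hle
      · exact (expRemainder_le_expRemainder (abs_nonneg _)
          (by rw [abs_of_nonneg (sub_nonneg.2 hle)]; linarith)).trans
          (le_add_of_nonneg_right (expRemainder_nonneg hM))
      · exact (expRemainder_le_expRemainder (abs_nonneg _)
          (by rw [abs_of_nonpos (sub_nonpos.2 hle)]; linarith)).trans
          (le_add_of_nonneg_left (expRemainder_nonneg hP))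
    nlinarith
  have i1 : Integrable (fun g : Fin d → ℝ => (g ⬝ᵥ u) * (g ⬝ᵥ v)) (Measure.pi fun _ => ν) := by
    simpa using integrable_dotProduct_mul hν u v 1 1
  have i2 := integrable_dotProduct_mul hν u v 2 2
  have iA := ((integrable_const (1 : ℝ)).sub (i1.const_mul s)).add (i2.const_mul (s ^ 2 / 2))
  have iB := ip.add im
  have hint : Integrable (fun g => Real.exp (-(s * ((g ⬝ᵥ u) * (g ⬝ᵥ v)))))
      (Measure.pi fun _ => ν) := by
    refine (iA.add iB).mono' ?_ (.of_forall fun g => ?_)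
    · exact ((((measurable_dotProduct_right u).mul (measurable_dotProduct_right v)).const_mul
        s).neg.exp).aestronglyMeasurable
    · rw [Real.norm_eq_abs, abs_of_pos (Real.exp_pos _)]
      exact hpt g
  refine ⟨hint, ?_⟩
  refine (integral_mono hint (iA.add iB) hpt).trans ?_
  refine le_trans ?_ (exponent_estimate h0 h1)
  rw [← hs]
  rw [integral_add' iA iB, integral_add' (by exact (integrable_const (1 : ℝ)).sub (i1.const_mul s))
    (i2.const_mul (s ^ 2 / 2)), integral_sub' (integrable_const (1 : ℝ)) (i1.const_mul s),
    integral_add' ip im, integral_const_mul, integral_const_mul, integral_dotProduct_mul hν, huv]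
  have h2 := integral_dotProduct_mul_sq_le hν u v
  rw [huv] at h2
  have h3 : (u ⬝ᵥ u) * (v ⬝ᵥ v) ≤ 1 := by
    have hv0 : 0 ≤ v ⬝ᵥ v := by
      simpa [dotProduct] using Finset.sum_nonneg fun i _ => mul_self_nonneg (v i)
    exact mul_le_one₀ hu hv0 hv
  have h4 := mul_le_mul_of_nonneg_left (h2.trans (add_le_add_left h3 _))
    (by positivity : 0 ≤ s ^ 2 / 2)
  simp only [integral_const, probReal_univ, smul_eq_mul, mul_one]
  linarith

end

/-! ### Tail and rank bounds for random matrices -/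

section

variable {ν : Measure ℝ} [IsProbabilityMeasure ν]

/-- A Chernoff bound: for vectors `y`, `w` with a positive inner product, and a matrix `R` with
independent entries of law `ν`, the images `R y` and `R w` rarely have a nonpositive inner product.
-/
lemma measure_sum_mul_nonpos_le (hν : HasDominatedMoments ν) {n d : ℕ} {y w : Fin d → ℝ}
    {N B q : ℝ} (hN : 0 < N) (hB : 0 < B) (hq : 0 < q) (hy : y ⬝ᵥ y ≤ N ^ 2)
    (hw : w ⬝ᵥ w ≤ B ^ 2) (hyw : q ≤ y ⬝ᵥ w) (hqNB : q / (N * B) ≤ 1 / 2) :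
    (Measure.pi fun _ : Fin n => Measure.pi fun _ : Fin d => ν)
      {R | ∑ l, (R l ⬝ᵥ y) * (R l ⬝ᵥ w) ≤ 0} ≤
    ENNReal.ofReal (Real.exp (-(0.339 * (q / (N * B)) ^ 2 / (1 + q / (N * B)))) ^ n) := by
  set ρ := q / (N * B) with hρ
  have hρ0 : 0 < ρ := by positivity
  set p := y ⬝ᵥ w with hp
  have hp0 : 0 < p := hq.trans_le hyw
  -- `y` is shrunk so that the inner product becomes exactly `ρ`
  set u : Fin d → ℝ := (q / p / N) • y with hu
  set v : Fin d → ℝ := (1 / B) • w with hv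
  have huu : u ⬝ᵥ u ≤ 1 := by
    have h1 : q / p / N ≤ 1 / N := by
      gcongr
      exact (div_le_one hp0).2 hyw
    simp only [hu, smul_dotProduct, dotProduct_smul, smul_eq_mul]
    calc q / p / N * (q / p / N * y ⬝ᵥ y) ≤ 1 / N * (1 / N * N ^ 2) := by
          have : 0 ≤ y ⬝ᵥ y := by
            simpa [dotProduct] using Finset.sum_nonneg fun i _ => mul_self_nonneg (y i)
          gcongr
      _ = 1 := by field_simp
  have hvv : v ⬝ᵥ v ≤ 1 := by
    simp only [hv, smul_dotProduct, dotProduct_smul, smul_eq_mul]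
    calc 1 / B * (1 / B * w ⬝ᵥ w) ≤ 1 / B * (1 / B * B ^ 2) := by gcongr
      _ = 1 := by field_simp
  have huv : u ⬝ᵥ v = ρ := by
    simp only [hu, hv, smul_dotProduct, dotProduct_smul, smul_eq_mul, ← hp, hρ]
    field_simp
  obtain ⟨hint, hle⟩ := integral_exp_neg_mul_le hν huu hvv huv hρ0 hqNB
  set f : (Fin d → ℝ) → ℝ := fun g => Real.exp (-(0.44 * ρ * ((g ⬝ᵥ u) * (g ⬝ᵥ v)))) with hf
  have hprod : Integrable (fun R : Fin n → Fin d → ℝ => ∏ l, f (R l))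
      (Measure.pi fun _ : Fin n => Measure.pi fun _ : Fin d => ν) :=
    Integrable.fintype_prod fun _ => hint
  have hmarkov := mul_meas_ge_le_integral_of_nonneg
    (.of_forall fun R => Finset.prod_nonneg fun l _ => (Real.exp_pos _).le) hprod 1
  rw [one_mul, integral_fintype_prod_eq_pow f] at hmarkov
  have hsub : {R : Fin n → Fin d → ℝ | ∑ l, (R l ⬝ᵥ y) * (R l ⬝ᵥ w) ≤ 0} ⊆
      {R | 1 ≤ ∏ l, f (R l)} := by
    intro R hR
    simp only [Set.mem_ofPred_eq, hf] at hR ⊢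
    rw [← Real.exp_sum, Real.one_le_exp_iff, Finset.sum_neg_distrib, ← Finset.mul_sum]
    have e : ∑ l, (R l ⬝ᵥ u) * (R l ⬝ᵥ v) =
        (q / p / N * (1 / B)) * ∑ l, (R l ⬝ᵥ y) * (R l ⬝ᵥ w) := by
      rw [Finset.mul_sum]
      refine Finset.sum_congr rfl fun l _ => ?_
      simp only [hu, hv, dotProduct_smul, smul_eq_mul]
      ring
    rw [e]
    have : q / p / N * (1 / B) * ∑ l, (R l ⬝ᵥ y) * (R l ⬝ᵥ w) ≤ 0 :=
      mul_nonpos_of_nonneg_of_nonpos (by positivity) hR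
    nlinarith
  refine (measure_mono hsub).trans ?_
  rw [← ofReal_measureReal]
  refine ENNReal.ofReal_le_ofReal (hmarkov.trans ?_)
  rw [Fintype.card_fin]
  exact pow_le_pow_left₀ (integral_nonneg fun g => (Real.exp_pos _).le) hle n

/-- A Paley-Zygmund bound: `⟨g, w⟩` vanishes with probability at most `2 / 3`. -/
lemma measure_dotProduct_eq_zero_le (hν : HasDominatedMoments ν) {d : ℕ} {w : Fin d → ℝ}
    (hw : w ≠ 0) :
    (Measure.pi fun _ : Fin d => ν) {g | g ⬝ᵥ w = 0} ≤ ENNReal.ofReal (2 / 3) := by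
  set σ := w ⬝ᵥ w with hσ
  have hσ0 : 0 < σ := by
    have h1 : 0 ≤ σ := by
      simpa [hσ, dotProduct] using Finset.sum_nonneg fun i _ => mul_self_nonneg (w i)
    exact lt_of_le_of_ne h1 fun h => hw (dotProduct_self_eq_zero.1 h.symm)
  -- the square of `1 - ⟨g, w⟩² / (3 ‖w‖²)` is one on the event and has mean at most `2 / 3`
  have e : ∀ g : Fin d → ℝ, (1 - 1 / (3 * σ) * (g ⬝ᵥ w) ^ 2) ^ 2 =
      1 - 2 / (3 * σ) * (g ⬝ᵥ w) ^ 2 + 1 / (9 * σ ^ 2) * (g ⬝ᵥ w) ^ (2 * 2) := by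
    intro g
    field_simp
    ring
  have i2 := (integrable_dotProduct_pow hν w 2).const_mul (2 / (3 * σ))
  have i4 := (integrable_dotProduct_pow hν w (2 * 2)).const_mul (1 / (9 * σ ^ 2))
  have i0 : Integrable (fun _ : Fin d → ℝ => (1 : ℝ)) (Measure.pi fun _ => ν) :=
    integrable_const 1
  have hint : Integrable (fun g => (1 - 1 / (3 * σ) * (g ⬝ᵥ w) ^ 2) ^ 2)
      (Measure.pi fun _ => ν) := by
    simp_rw [e]
    exact (i0.sub i2).add i4
  have hmarkov := mul_meas_ge_le_integral_of_nonneg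
    (.of_forall fun g => sq_nonneg (1 - 1 / (3 * σ) * (g ⬝ᵥ w) ^ 2)) hint 1
  rw [one_mul] at hmarkov
  have hsub : {g : Fin d → ℝ | g ⬝ᵥ w = 0} ⊆
      {g | 1 ≤ (1 - 1 / (3 * σ) * (g ⬝ᵥ w) ^ 2) ^ 2} := by
    intro g hg
    simp only [Set.mem_ofPred_eq] at hg ⊢
    simp [hg]
  refine (measure_mono hsub).trans ?_
  rw [← ofReal_measureReal]
  refine ENNReal.ofReal_le_ofReal (hmarkov.trans ?_)
  simp_rw [e]
  rw [integral_add (by exact i0.sub i2) i4, integral_sub i0 i2, integral_const_mul,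
    integral_const_mul, integral_dotProduct_sq hν]
  have h4 := integral_dotProduct_pow_even_le hν w 2
  rw [normalMoment_two, ← hσ] at h4
  simp only [integral_const, probReal_univ, smul_eq_mul, mul_one, ← hσ]
  calc _ ≤ 1 - 2 / (3 * σ) * σ + 1 / (9 * σ ^ 2) * (3 * σ ^ 2) := by gcongr
    _ = 2 / 3 := by field_simp; norm_num

end

/-- The matrices with rows `R l` whose kernel meets the subspace `W` nontrivially. -/
def kernelMeets (n : ℕ) {d : ℕ} (W : Submodule ℝ (Fin d → ℝ)) : Set (Fin n → Fin d → ℝ) :=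
  {R | ∃ v ∈ W, v ≠ 0 ∧ ∀ l, R l ⬝ᵥ v = 0}

/-- The set is closed because it is the projection of a closed set along the unit sphere of `W`. -/
lemma isClosed_kernelMeets (n : ℕ) {d : ℕ} (W : Submodule ℝ (Fin d → ℝ)) :
    IsClosed (kernelMeets n W) := by
  set C : Set (Fin d → ℝ) := (W : Set (Fin d → ℝ)) ∩ Metric.sphere 0 1
  have hC : IsCompact C := (isCompact_sphere 0 1).inter_left W.closed_of_finiteDimensional
  have : CompactSpace C := isCompact_iff_compactSpace.1 hC
  have hcl : IsClosed {p : (Fin n → Fin d → ℝ) × C | ∀ l, p.1 l ⬝ᵥ (p.2 : Fin d → ℝ) = 0} := by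
    rw [Set.ofPred_forall]
    refine isClosed_iInter fun l => isClosed_eq ?_ continuous_const
    have h1 : Continuous fun p : (Fin n → Fin d → ℝ) × C => (p.2 : Fin d → ℝ) :=
      continuous_subtype_val.comp continuous_snd
    have h2 : Continuous fun p : (Fin n → Fin d → ℝ) × C => p.1 l :=
      (continuous_apply l).comp continuous_fst
    exact h2.dotProduct h1
  convert! isClosedMap_fst_of_compactSpace _ hcl using 1
  ext R
  constructor
  · rintro ⟨v, hv, hv0, hR⟩
    have hn : ‖v‖ ≠ 0 := norm_ne_zero_iff.2 hv0
    refine ⟨(R, ⟨‖v‖⁻¹ • v, W.smul_mem _ hv, ?_⟩), fun l => ?_, rfl⟩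
    · simp [norm_smul, hn]
    · simp [dotProduct_smul, hR l]
  · rintro ⟨⟨R', ⟨v, hv, hv1⟩⟩, h, rfl⟩
    refine ⟨v, hv, ?_, h⟩
    rintro rfl
    simp at hv1

/-- The hyperplane (the whole space if `a = 0`) of the vectors orthogonal to `a`. -/
def orthogonalHyperplane {d : ℕ} (a : Fin d → ℝ) : Submodule ℝ (Fin d → ℝ) where
  carrier := {v | a ⬝ᵥ v = 0}
  add_mem' {v w} hv hw := by
    simp only [Set.mem_ofPred_eq] at *
    rw [dotProduct_add, hv, hw, add_zero]
  zero_mem' := by simp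
  smul_mem' c v hv := by
    simp only [Set.mem_ofPred_eq] at *
    rw [dotProduct_smul, hv, smul_zero]

lemma mem_orthogonalHyperplane {d : ℕ} {a v : Fin d → ℝ} :
    v ∈ orthogonalHyperplane a ↔ a ⬝ᵥ v = 0 := Iff.rfl

lemma cons_mem_kernelMeets {n d : ℕ} {W : Submodule ℝ (Fin d → ℝ)} {a : Fin d → ℝ}
    {R : Fin n → Fin d → ℝ} :
    (Fin.cons a R : Fin (n + 1) → Fin d → ℝ) ∈ kernelMeets (n + 1) W ↔
      R ∈ kernelMeets n (W ⊓ orthogonalHyperplane a) := by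
  constructor
  · rintro ⟨v, hv, hv0, h⟩
    exact ⟨v, ⟨hv, mem_orthogonalHyperplane.2 (by simpa using h 0)⟩, hv0,
      fun l => by simpa using h l.succ⟩
  · rintro ⟨v, ⟨hv, hva⟩, hv0, h⟩
    refine ⟨v, hv, hv0, fun l => ?_⟩
    refine Fin.cases ?_ (fun l => ?_) l
    · simpa using mem_orthogonalHyperplane.1 hva
    · simpa using h l

/-- A random matrix with many more rows than `dim W` is injective on `W` with large probability:
each new row cuts the part of `W` in the kernel of the earlier rows, while it is nonzero, with
conditional probability at least `1 / 3`. -/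
lemma measure_kernelMeets_le {ν : Measure ℝ} [IsProbabilityMeasure ν]
    (hν : HasDominatedMoments ν) (n : ℕ) {d : ℕ} (W : Submodule ℝ (Fin d → ℝ)) :
    (Measure.pi fun _ : Fin n => Measure.pi fun _ : Fin d => ν) (kernelMeets n W) ≤
      ENNReal.ofReal (3 ^ Module.finrank ℝ W * (7 / 9) ^ n) := by
  induction n generalizing W with
  | zero =>
    refine prob_le_one.trans ?_
    rw [ENNReal.one_le_ofReal, pow_zero, mul_one]
    exact one_le_pow₀ (by norm_num)
  | succ n ih =>
    by_cases hW : W = ⊥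
    · have : kernelMeets (n + 1) W = ∅ := by
        ext R
        simp only [kernelMeets, hW, Submodule.mem_bot, Set.mem_ofPred_eq, Set.mem_empty_iff_false,
          iff_false]
        rintro ⟨v, hv, hv0, -⟩
        exact hv0 hv
      simp [this]
    obtain ⟨w, hwW, hw0⟩ := W.ne_bot_iff.1 hW
    set b : ℝ := 3 ^ Module.finrank ℝ W * (7 / 9) ^ n with hb
    have hb0 : 0 ≤ b := by positivity
    set μ : Measure (Fin d → ℝ) := Measure.pi fun _ => ν
    have hm : MeasurableSet (kernelMeets (n + 1) W) := (isClosed_kernelMeets _ W).measurableSet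
    rw [← (measurePreserving_cons μ n).measure_preimage hm.nullMeasurableSet,
      Measure.prod_apply ((measurePreserving_cons μ n).measurable hm)]
    have hslice : ∀ a : Fin d → ℝ, (Measure.pi fun _ : Fin n => μ)
        (Prod.mk a ⁻¹' ((fun p : (Fin d → ℝ) × (Fin n → Fin d → ℝ) =>
          (Fin.cons p.1 p.2 : Fin (n + 1) → Fin d → ℝ)) ⁻¹' kernelMeets (n + 1) W)) ≤
        ENNReal.ofReal (b / 3) + {g : Fin d → ℝ | g ⬝ᵥ w = 0}.indicator
          (fun _ => ENNReal.ofReal (2 * b / 3)) a := by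
      intro a
      have e : (Prod.mk a ⁻¹' ((fun p : (Fin d → ℝ) × (Fin n → Fin d → ℝ) =>
          (Fin.cons p.1 p.2 : Fin (n + 1) → Fin d → ℝ)) ⁻¹' kernelMeets (n + 1) W)) =
          kernelMeets n (W ⊓ orthogonalHyperplane a) := by
        ext R
        exact cons_mem_kernelMeets
      rw [e]
      refine (ih _).trans ?_
      by_cases ha : a ⬝ᵥ w = 0
      · rw [Set.indicator_of_mem (by exact ha), ← ENNReal.ofReal_add (by positivity)
          (by positivity)]
        apply ENNReal.ofReal_le_ofReal
        have h1 : Module.finrank ℝ ↥(W ⊓ orthogonalHyperplane a) ≤ Module.finrank ℝ W :=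
          Submodule.finrank_mono inf_le_left
        have h2 : (3 : ℝ) ^ Module.finrank ℝ ↥(W ⊓ orthogonalHyperplane a) * (7 / 9) ^ n ≤ b := by
          rw [hb]
          gcongr
          norm_num
        linarith
      · rw [Set.indicator_of_notMem (by exact ha), add_zero]
        apply ENNReal.ofReal_le_ofReal
        have h1 : Module.finrank ℝ ↥(W ⊓ orthogonalHyperplane a) < Module.finrank ℝ W := by
          refine Submodule.finrank_lt_finrank_of_lt (lt_of_le_of_ne inf_le_left fun h => ha ?_)
          exact mem_orthogonalHyperplane.1 (inf_eq_left.1 h hwW)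
        have h2 : (3 : ℝ) ^ (Module.finrank ℝ ↥(W ⊓ orthogonalHyperplane a) + 1) * (7 / 9) ^ n ≤
            b := by
          rw [hb]
          gcongr
          · norm_num
          · exact h1
        rw [pow_succ] at h2
        linarith
    refine (lintegral_mono hslice).trans ?_
    have hms : MeasurableSet {g : Fin d → ℝ | g ⬝ᵥ w = 0} :=
      (measurable_dotProduct_right w) (measurableSet_singleton 0)
    rw [lintegral_add_left measurable_const, lintegral_const, measure_univ, mul_one,
      lintegral_indicator_const hms]
    calc _ ≤ ENNReal.ofReal (b / 3) + ENNReal.ofReal (2 * b / 3) * ENNReal.ofReal (2 / 3) := by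
          gcongr
          exact measure_dotProduct_eq_zero_le hν hw0
      _ = ENNReal.ofReal (3 ^ Module.finrank ℝ W * (7 / 9) ^ (n + 1)) := by
          rw [← ENNReal.ofReal_mul (by positivity), ← ENNReal.ofReal_add (by positivity)
            (by positivity)]
          congr 1
          rw [hb]
          ring

/-! ### Gaussian and Bernoulli matrices -/

lemma normalMoment_eq_doubleFactorial (k : ℕ) :
    normalMoment k = (Nat.doubleFactorial (2 * k - 1) : ℝ) := by
  cases k with
  | zero => simp [normalMoment]
  | succ k =>
    have h1 := Nat.factorial_eq_mul_doubleFactorial (2 * k + 1)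
    have h2 := Nat.doubleFactorial_two_mul (k + 1)
    rw [show 2 * k + 1 + 1 = 2 * (k + 1) by ring, h2] at h1
    unfold normalMoment
    rw [h1, show 2 * (k + 1) - 1 = 2 * k + 1 by omega]
    push_cast
    field_simp

lemma integral_pow_even_gaussianReal (k : ℕ) :
    ∫ x, x ^ (2 * k) ∂(gaussianReal 0 1) = normalMoment k := by
  rw [integral_gaussianReal_eq_integral_smul one_ne_zero]
  have e : ∀ x : ℝ, gaussianPDFReal 0 1 x • x ^ (2 * k) =
      (√(2 * Real.pi))⁻¹ * (|x| ^ ((2 * k : ℕ) : ℝ) * Real.exp (-(1 / 2) * |x| ^ (2 : ℝ))) := by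
    intro x
    rw [gaussianPDFReal, Real.rpow_natCast, Real.rpow_two, pow_mul |x|, sq_abs, ← pow_mul]
    simp
    ring_nf
  simp_rw [e]
  have h0 : (-1 : ℝ) < ((2 * k : ℕ) : ℝ) := by
    have : (0 : ℝ) ≤ ((2 * k : ℕ) : ℝ) := by positivity
    linarith
  rw [integral_const_mul, integral_comp_abs
      (f := fun x => x ^ ((2 * k : ℕ) : ℝ) * Real.exp (-(1 / 2) * x ^ (2 : ℝ))),
    integral_rpow_mul_exp_neg_mul_rpow two_pos h0 (by norm_num),
    show (((2 * k : ℕ) : ℝ) + 1) / 2 = k + 1 / 2 by push_cast; ring,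
    Real.Gamma_nat_add_half, ← normalMoment_eq_doubleFactorial]
  have h1 : (1 / 2 : ℝ) ^ (-(((2 * k : ℕ) : ℝ) + 1) / 2) = 2 ^ k * √2 := by
    rw [show -(((2 * k : ℕ) : ℝ) + 1) / 2 = -(k + 1 / 2) by push_cast; ring,
      one_div, Real.inv_rpow two_pos.le, Real.rpow_neg two_pos.le, inv_inv,
      Real.rpow_add two_pos, Real.rpow_natCast, Real.sqrt_eq_rpow, one_div]
  have h2 : √Real.pi ≠ 0 := (Real.sqrt_pos.2 Real.pi_pos).ne'
  rw [h1, Real.sqrt_mul two_pos.le]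
  field_simp

lemma hasDominatedMoments_gaussianReal : HasDominatedMoments (gaussianReal 0 1) where
  integrable_pow k := by
    have h := (memLp_id_gaussianReal (μ := 0) (v := 1) (k : ℝ≥0)).integrable_norm_pow'
    refine h.mono' (by fun_prop) (.of_forall fun x => ?_)
    simp
  integral_odd k := by
    have h : ∫ x, x ^ (2 * k + 1) ∂(gaussianReal 0 1) =
        ∫ x, (-x) ^ (2 * k + 1) ∂(gaussianReal 0 1) := by
      conv_lhs => rw [← neg_zero, ← gaussianReal_map_neg]
      rw [integral_map (by fun_prop) (by fun_prop)]
    simp_rw [Odd.neg_pow ⟨k, rfl⟩] at h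
    rw [integral_neg] at h
    linarith
  integral_sq := by
    have h := integral_pow_even_gaussianReal 1
    norm_num [normalMoment] at h
    exact h
  integral_even_le k := (integral_pow_even_gaussianReal k).le

/-- The uniform law on `{1, -1}`. -/
noncomputable def rademacher : Measure ℝ :=
  (2⁻¹ : ℝ≥0∞) • Measure.dirac 1 + (2⁻¹ : ℝ≥0∞) • Measure.dirac (-1)

instance : IsProbabilityMeasure rademacher :=
  ⟨by simp [rademacher, ENNReal.inv_two_add_inv_two]⟩

lemma integrable_rademacher (f : ℝ → ℝ) : Integrable f rademacher := by
  refine Integrable.add_measure ?_ ?_ <;>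
    exact (integrable_dirac (by simp)).smul_measure (by simp)

lemma integral_rademacher (f : ℝ → ℝ) : ∫ x, f x ∂rademacher = (f 1 + f (-1)) / 2 := by
  have h1 : ∀ a : ℝ, Integrable f ((2⁻¹ : ℝ≥0∞) • Measure.dirac a) := fun a =>
    (integrable_dirac (by simp)).smul_measure (by simp)
  rw [rademacher, integral_add_measure (h1 1) (h1 (-1)), integral_smul_measure,
    integral_smul_measure, integral_dirac, integral_dirac]
  simp
  ring

lemma one_le_normalMoment (k : ℕ) : 1 ≤ normalMoment k := by
  rw [normalMoment_eq_doubleFactorial]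
  exact_mod_cast Nat.doubleFactorial_pos _

lemma hasDominatedMoments_rademacher : HasDominatedMoments rademacher where
  integrable_pow k := integrable_rademacher _
  integral_odd k := by
    rw [integral_rademacher, Odd.neg_pow ⟨k, rfl⟩]
    simp
  integral_sq := by
    rw [integral_rademacher]
    norm_num
  integral_even_le k := by
    rw [integral_rademacher, pow_mul, pow_mul]
    norm_num
    exact one_le_normalMoment k

section

variable {Ω : Type*} [MeasurableSpace Ω] {P : Measure Ω}

/-- A matrix with independent entries of law `ν` has independent rows, and each row has independent
entries. -/
lemma hasLaw_rows {ν : Measure ℝ} [IsProbabilityMeasure ν] {n d : ℕ}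
    {G : Ω → Matrix (Fin n) (Fin d) ℝ}
    (hind : iIndepFun (fun (p : Fin n × Fin d) ω => G ω p.1 p.2) P)
    (hlaw : ∀ i j, HasLaw (fun ω => G ω i j) ν P) :
    HasLaw (fun ω i j => G ω i j)
      (Measure.pi fun _ : Fin n => Measure.pi fun _ : Fin d => ν) P := by
  set Q : Measure (Fin n → Fin d → ℝ) := Measure.pi fun _ : Fin n => Measure.pi fun _ : Fin d => ν
  have h1 : HasLaw (fun ω (p : Fin n × Fin d) => G ω p.1 p.2) (Measure.pi fun _ => ν) P :=
    hind.hasLaw_pi fun p => hlaw p.1 p.2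
  have hentry : ∀ i j, HasLaw (fun R : Fin n → Fin d → ℝ => R i j) ν Q := fun i j =>
    ⟨(by fun_prop : Measurable fun R : Fin n → Fin d → ℝ => R i j).aemeasurable, by
      rw [show (fun R : Fin n → Fin d → ℝ => R i j) = (fun r : Fin d → ℝ => r j) ∘
        (fun R : Fin n → Fin d → ℝ => R i) from rfl,
        ← Measure.map_map (by fun_prop) (by fun_prop),
        (measurePreserving_eval (fun _ : Fin n => Measure.pi fun _ : Fin d => ν) i).map_eq,
        (measurePreserving_eval (fun _ : Fin d => ν) j).map_eq]⟩
  have hQ : iIndepFun (fun (p : Fin n × Fin d) (R : Fin n → Fin d → ℝ) => R p.1 p.2) Q := by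
    have h := iIndepFun_uncurry_infinitePi' (X := fun (_ : Fin n) (_ : Fin d) (x : ℝ) => x)
      (fun _ _ => ν) (fun _ _ => measurable_id)
    simpa only [Measure.infinitePi_eq_pi] using h
  have h2 : HasLaw (fun (R : Fin n → Fin d → ℝ) (p : Fin n × Fin d) => R p.1 p.2)
      (Measure.pi fun _ => ν) Q := hQ.hasLaw_pi fun p => hentry p.1 p.2
  have hG : AEMeasurable (fun ω (i : Fin n) (j : Fin d) => G ω i j) P :=
    aemeasurable_pi_lambda _ fun i => aemeasurable_pi_lambda _ fun j => (hlaw i j).aemeasurable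
  refine ⟨hG, ?_⟩
  have hc : Measurable (fun (f : Fin n × Fin d → ℝ) (i : Fin n) (j : Fin d) => f (i, j)) := by
    fun_prop
  calc P.map (fun ω i j => G ω i j)
      = (P.map (fun ω (p : Fin n × Fin d) => G ω p.1 p.2)).map
          (fun f i j => f (i, j)) := by
        rw [AEMeasurable.map_map_of_aemeasurable hc.aemeasurable h1.aemeasurable]
        rfl
    _ = (Q.map (fun R (p : Fin n × Fin d) => R p.1 p.2)).map (fun f i j => f (i, j)) := by
        rw [h1.map_eq, h2.map_eq]
    _ = Q := by
        rw [AEMeasurable.map_map_of_aemeasurable hc.aemeasurable h2.aemeasurable]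
        exact Measure.map_id

/-- After multiplication by `√n`, the rows of a Gaussian or Bernoulli matrix are independent, with
independent entries of variance one whose law has dominated moments. -/
lemma exists_hasLaw_rows {n d : ℕ} (hn : n ≠ 0) {A : Ω → Matrix (Fin n) (Fin d) ℝ}
    (hA : IsGaussianEnsemble P A ∨ IsBernoulliEnsemble P A) :
    ∃ ν : Measure ℝ, IsProbabilityMeasure ν ∧ HasDominatedMoments ν ∧
      HasLaw (fun ω i j => √n * A ω i j)
        (Measure.pi fun _ : Fin n => Measure.pi fun _ : Fin d => ν) P := by
  have hn0 : (0 : ℝ) < n := by exact_mod_cast Nat.pos_of_ne_zero hn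
  have hs : √(n : ℝ) ≠ 0 := (Real.sqrt_pos.2 hn0).ne'
  rcases hA with ⟨hind, hlaw⟩ | ⟨hind, hlaw⟩
  · refine ⟨gaussianReal 0 1, inferInstance, hasDominatedMoments_gaussianReal,
      hasLaw_rows (G := fun ω => √n • A ω) ?_ fun i j => ?_⟩
    · exact hind.comp (fun _ x => √n * x) fun _ => by fun_prop
    · have h := gaussianReal_const_mul (hlaw i j) (√(n : ℝ))
      convert! h using 2
      · simp
      · ext
        simp [Real.sq_sqrt hn0.le, hn0.ne']
  · refine ⟨rademacher, inferInstance, hasDominatedMoments_rademacher,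
      hasLaw_rows (G := fun ω => √n • A ω) ?_ fun i j => ?_⟩
    · exact hind.comp (fun _ x => √n * x) fun _ => by fun_prop
    · have hm : Measurable fun x : ℝ => √(n : ℝ) * x := by fun_prop
      refine HasLaw.fun_comp (Y := fun x => √(n : ℝ) * x) ⟨hm.aemeasurable, ?_⟩ (hlaw i j)
      rw [Measure.map_add _ _ hm, Measure.map_smul, Measure.map_smul,
        Measure.map_dirac' hm, Measure.map_dirac' hm, rademacher]
      congr 3 <;> field_simp

end

/-! ### The Babel function and deterministic recovery -/

section Babel

variable {d K : ℕ} {Ψ : Matrix (Fin d) (Fin K) ℝ}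

/-- The column `ψ j` of the dictionary. -/
def atom (Ψ : Matrix (Fin d) (Fin K) ℝ) (j : Fin K) : Fin d → ℝ := fun l => Ψ l j

lemma sum_le_babel (Ψ : Matrix (Fin d) (Fin K) ℝ) {Λ : Finset (Fin K)} {j : Fin K} {k : ℕ}
    (hk : Λ.card = k) (hj : j ∉ Λ) :
    ∑ i ∈ Λ, |atom Ψ i ⬝ᵥ atom Ψ j| ≤ babel Ψ k := by
  refine le_csSup ?_ ⟨Λ, j, hk, hj, rfl⟩
  have hfin : (Set.range fun p : Finset (Fin K) × Fin K =>
      ∑ i ∈ p.1, |atom Ψ i ⬝ᵥ atom Ψ p.2|).Finite := Set.finite_range _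
  refine hfin.bddAbove.mono ?_
  rintro r ⟨Λ', j', -, -, rfl⟩
  exact ⟨(Λ', j'), rfl⟩

lemma babel_nonneg (Ψ : Matrix (Fin d) (Fin K) ℝ) (k : ℕ) : 0 ≤ babel Ψ k := by
  refine Real.sSup_nonneg ?_
  rintro r ⟨Λ, j, -, -, rfl⟩
  exact Finset.sum_nonneg fun _ _ => abs_nonneg _

lemma babel_le {k : ℕ} {r : ℝ} (hr : 0 ≤ r)
    (h : ∀ (Λ : Finset (Fin K)) (j : Fin K), Λ.card = k → j ∉ Λ →
      ∑ i ∈ Λ, |atom Ψ i ⬝ᵥ atom Ψ j| ≤ r) : babel Ψ k ≤ r := by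
  refine Real.sSup_le ?_ hr
  rintro _ ⟨Λ, j, hk, hj, rfl⟩
  exact h Λ j hk hj

lemma babel_zero (Ψ : Matrix (Fin d) (Fin K) ℝ) : babel Ψ 0 = 0 := by
  refine le_antisymm (babel_le le_rfl fun Λ j hk _ => ?_) (babel_nonneg _ _)
  rw [Finset.card_eq_zero.1 hk, Finset.sum_empty]

lemma babel_le_babel_succ {k : ℕ} (hk : k + 1 < K) : babel Ψ k ≤ babel Ψ (k + 1) := by
  refine babel_le (babel_nonneg _ _) fun Λ j hc hj => ?_
  -- `k + 1 < K` leaves an index outside `Λ ∪ {j}`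
  obtain ⟨i, hi⟩ : ∃ i, i ∉ insert j Λ := by
    by_contra! h
    have h1 : insert j Λ = Finset.univ := Finset.eq_univ_iff_forall.2 h
    have h2 := Finset.card_insert_of_notMem hj
    rw [h1, Finset.card_univ, Fintype.card_fin] at h2
    omega
  rw [Finset.mem_insert, not_or] at hi
  refine le_trans ?_ (sum_le_babel Ψ (Λ := insert i Λ) (j := j)
    (by rw [Finset.card_insert_of_notMem hi.2, hc]) ?_)
  · exact Finset.sum_le_sum_of_subset_of_nonneg (Finset.subset_insert _ _)
      fun _ _ _ => abs_nonneg _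
  · rw [Finset.mem_insert, not_or]
    exact ⟨fun h => hi.1 h.symm, hj⟩

lemma babel_mono {j k : ℕ} (hjk : j ≤ k) (hk : k < K) : babel Ψ j ≤ babel Ψ k := by
  induction k, hjk using Nat.le_induction with
  | base => exact le_rfl
  | succ k _ ih => exact (ih (by omega)).trans (babel_le_babel_succ hk)

lemma abs_dotProduct_le_babel_one (Ψ : Matrix (Fin d) (Fin K) ℝ) {i j : Fin K} (h : i ≠ j) :
    |atom Ψ i ⬝ᵥ atom Ψ j| ≤ babel Ψ 1 := by
  simpa using sum_le_babel Ψ (Λ := {i}) (j := j) (Finset.card_singleton i)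
    (by simpa using h.symm)

lemma atom_dotProduct_self (hΨ : IsDictionary Ψ) (j : Fin K) : atom Ψ j ⬝ᵥ atom Ψ j = 1 := by
  rw [← hΨ j]
  simp [atom, dotProduct, sq]

lemma mulVec_dotProduct (Ψ : Matrix (Fin d) (Fin K) ℝ) (x : Fin K → ℝ) (v : Fin d → ℝ) :
    (Ψ *ᵥ x) ⬝ᵥ v = ∑ i, x i * (atom Ψ i ⬝ᵥ v) := by
  rw [dotProduct_comm, Matrix.dotProduct_mulVec, dotProduct_comm]
  simp only [dotProduct, Matrix.vecMul, atom]
  refine Finset.sum_congr rfl fun i _ => ?_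
  congr 1
  exact Finset.sum_congr rfl fun l _ => mul_comm _ _

variable {Λ : Finset (Fin K)} {x : Fin K → ℝ}

lemma mulVec_dotProduct_of_support (hx : ∀ i ∉ Λ, x i = 0) (v : Fin d → ℝ) :
    (Ψ *ᵥ x) ⬝ᵥ v = ∑ i ∈ Λ, x i * (atom Ψ i ⬝ᵥ v) := by
  rw [mulVec_dotProduct]
  refine (Finset.sum_subset (Finset.subset_univ _) fun i _ hi => ?_).symm
  rw [hx i hi, zero_mul]

lemma abs_sum_mul_le (s : Finset (Fin K)) (v : Fin d → ℝ) :
    |∑ i ∈ s, x i * (atom Ψ i ⬝ᵥ v)| ≤ ‖x‖ * ∑ i ∈ s, |atom Ψ i ⬝ᵥ v| := by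
  rw [Finset.mul_sum]
  refine (Finset.abs_sum_le_sum_abs _ _).trans (Finset.sum_le_sum fun i _ => ?_)
  rw [abs_mul]
  gcongr
  exact norm_le_pi_norm x i

lemma abs_dotProduct_atom_le (hx : ∀ i ∉ Λ, x i = 0) {k : Fin K} (hk : k ∉ Λ) :
    |(Ψ *ᵥ x) ⬝ᵥ atom Ψ k| ≤ ‖x‖ * babel Ψ Λ.card := by
  rw [mulVec_dotProduct_of_support hx]
  refine (abs_sum_mul_le _ _).trans ?_
  gcongr
  exact sum_le_babel Ψ rfl hk

lemma abs_dotProduct_atom_sub_le (hΨ : IsDictionary Ψ) (hx : ∀ i ∉ Λ, x i = 0) {i : Fin K}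
    (hi : i ∈ Λ) :
    |(Ψ *ᵥ x) ⬝ᵥ atom Ψ i - x i| ≤ ‖x‖ * babel Ψ (Λ.card - 1) := by
  rw [mulVec_dotProduct_of_support hx, ← Finset.add_sum_erase _ _ hi, atom_dotProduct_self hΨ,
    mul_one, add_sub_cancel_left]
  refine (abs_sum_mul_le _ _).trans ?_
  gcongr
  exact sum_le_babel Ψ (Finset.card_erase_of_mem hi) (Finset.notMem_erase _ _)

lemma mulVec_dotProduct_self_le (hΨ : IsDictionary Ψ) (hx : ∀ i ∉ Λ, x i = 0) :
    (Ψ *ᵥ x) ⬝ᵥ (Ψ *ᵥ x) ≤ ‖x‖ ^ 2 * (Λ.card * (1 + babel Ψ (Λ.card - 1))) := by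
  rw [mulVec_dotProduct_of_support hx]
  have h : ∀ i ∈ Λ, x i * (atom Ψ i ⬝ᵥ (Ψ *ᵥ x)) ≤
      ‖x‖ * (‖x‖ * (1 + babel Ψ (Λ.card - 1))) := by
    intro i hi
    have h1 := abs_dotProduct_atom_sub_le hΨ hx hi
    have h2 : |x i| ≤ ‖x‖ := norm_le_pi_norm x i
    have h3 : |(Ψ *ᵥ x) ⬝ᵥ atom Ψ i| ≤ ‖x‖ * (1 + babel Ψ (Λ.card - 1)) := by
      have := abs_sub_abs_le_abs_sub ((Ψ *ᵥ x) ⬝ᵥ atom Ψ i) (x i)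
      linarith
    rw [dotProduct_comm]
    refine (le_abs_self _).trans ?_
    rw [abs_mul]
    gcongr
  refine (Finset.sum_le_sum h).trans (le_of_eq ?_)
  rw [Finset.sum_const, nsmul_eq_mul]
  ring

/-- The Gram matrix of the atoms in `Λ` is diagonally dominant, so that they are linearly
independent. -/
lemma eq_zero_of_mulVec_eq_zero (hΨ : IsDictionary Ψ) (hm : babel Ψ (Λ.card - 1) < 1)
    (hx : ∀ i ∉ Λ, x i = 0) (h : Ψ *ᵥ x = 0) : x = 0 := by
  by_contra hx0
  have hpos : 0 < ‖x‖ := norm_pos_iff.2 hx0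
  have : Nonempty (Fin K) := by
    by_contra hne
    rw [not_nonempty_iff] at hne
    exact hx0 (Subsingleton.elim _ _)
  obtain ⟨i, hi⟩ := Finite.exists_max fun i => ‖x i‖
  have hxi : ‖x‖ ≤ ‖x i‖ := (pi_norm_le_iff_of_nonneg (norm_nonneg _)).2 hi
  have hiΛ : i ∈ Λ := by
    by_contra hiΛ
    rw [hx i hiΛ, norm_zero] at hxi
    linarith
  have h1 := abs_dotProduct_atom_sub_le hΨ hx hiΛ
  rw [h, zero_dotProduct, zero_sub, abs_neg, ← Real.norm_eq_abs] at h1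
  nlinarith

end Babel

section Recovery

variable {n K : ℕ} {Φ : Matrix (Fin n) (Fin K) ℝ} {Λ : Finset (Fin K)}

/-- If `B` is injective, then `(Bᵀ B)⁻¹ Bᵀ` is its pseudo-inverse. -/
lemma isPseudoInverse_of_injective {m ι : Type*} [Fintype m] [Fintype ι] [DecidableEq ι]
    {B : Matrix m ι ℝ} (hB : ∀ c, B *ᵥ c = 0 → c = 0) :
    IsPseudoInverse B ((Bᵀ * B)⁻¹ * Bᵀ) := by
  have hdet : IsUnit (Bᵀ * B).det := by
    rw [← Matrix.isUnit_iff_isUnit_det, ← Matrix.mulVec_injective_iff_isUnit,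
      ← Matrix.coe_mulVecLin, ← LinearMap.ker_eq_bot, LinearMap.ker_eq_bot']
    intro c hc
    rw [Matrix.mulVecLin_apply] at hc
    refine hB c (dotProduct_self_eq_zero.1 ?_)
    rw [Matrix.dotProduct_mulVec, Matrix.vecMul_mulVec, ← Matrix.dotProduct_mulVec, hc,
      dotProduct_zero]
  have h1 : (Bᵀ * B)⁻¹ * Bᵀ * B = 1 := by
    rw [Matrix.mul_assoc, Matrix.nonsing_inv_mul _ hdet]
  refine ⟨?_, ?_, ?_, ?_⟩
  · rw [Matrix.mul_assoc, h1, Matrix.mul_one]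
  · rw [h1, Matrix.one_mul]
  · simp only [Matrix.transpose_mul, Matrix.transpose_transpose, Matrix.transpose_nonsing_inv,
      Matrix.mul_assoc]
  · rw [h1, Matrix.transpose_one]

lemma IsPseudoInverse.mulVec_mulVec {m ι : Type*} [Fintype m] [Fintype ι]
    {B : Matrix m ι ℝ} {Q : Matrix ι m ℝ} (h : IsPseudoInverse B Q)
    (hB : ∀ c, B *ᵥ c = 0 → c = 0) (c : ι → ℝ) : Q *ᵥ (B *ᵥ c) = c := by
  refine sub_eq_zero.1 (hB _ ?_)
  rw [Matrix.mulVec_sub, Matrix.mulVec_mulVec, Matrix.mulVec_mulVec, h.1, sub_self]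

lemma columns_mulVec {x : Fin K → ℝ} (hx : ∀ i ∉ Λ, x i = 0) :
    columns Φ Λ *ᵥ (fun i : Λ => x i) = Φ *ᵥ x := by
  ext l
  simp only [Matrix.mulVec, dotProduct, columns]
  rw [Finset.sum_coe_sort Λ fun i => Φ l i * x i]
  refine Finset.sum_subset (Finset.subset_univ _) fun i _ hi => ?_
  rw [hx i hi, mul_zero]

/-- Thresholding recovers `x` if the columns in the support are linearly independent and strictly
more correlated with the measurements than the other columns. -/
lemma recovers_of_separated {d : ℕ} {A : Matrix (Fin n) (Fin d) ℝ}
    {Ψ : Matrix (Fin d) (Fin K) ℝ} {x : Fin K → ℝ} (hx : ∀ i ∉ Λ, x i = 0)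
    (hinj : ∀ c : Fin K → ℝ, (∀ i ∉ Λ, c i = 0) → (A * Ψ) *ᵥ c = 0 → c = 0)
    (hsep : ∀ i ∈ Λ, ∀ k ∉ Λ, |(A *ᵥ (Ψ *ᵥ x)) ⬝ᵥ (fun l => (A * Ψ) l k)| <
      |(A *ᵥ (Ψ *ᵥ x)) ⬝ᵥ (fun l => (A * Ψ) l i)|) :
    Recovers A Ψ Λ.card x := by
  have hB : ∀ c, columns (A * Ψ) Λ *ᵥ c = 0 → c = 0 := by
    intro c hc
    set c' : Fin K → ℝ := fun i => if h : i ∈ Λ then c ⟨i, h⟩ else 0 with hc'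
    have hs : ∀ i ∉ Λ, c' i = 0 := fun i hi => by simp [hc', hi]
    have e : (fun i : Λ => c' i) = c := by
      ext i
      simp [hc']
    have h0 := hinj c' hs (by rw [← columns_mulVec hs, e, hc])
    rw [← e, h0]
    rfl
  have hs : A *ᵥ (Ψ *ᵥ x) = columns (A * Ψ) Λ *ᵥ (fun i : Λ => x i) := by
    rw [columns_mulVec hx, Matrix.mulVec_mulVec]
  have key : ∀ z, IsOutput (A * Ψ) Λ.card (A *ᵥ (Ψ *ᵥ x)) z ↔ z = x := by
    intro z
    constructor
    · rintro ⟨Λ', hcard, htop, Q, hQ, hz, hz0⟩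
      have hΛ : Λ' = Λ := by
        by_contra hne
        have h1 : ¬ Λ ⊆ Λ' := fun h => hne (Finset.eq_of_subset_of_card_le h hcard.le).symm
        have h2 : ¬ Λ' ⊆ Λ := fun h => hne (Finset.eq_of_subset_of_card_le h hcard.ge)
        obtain ⟨i, hi, hi'⟩ := Finset.not_subset.1 h1
        obtain ⟨k, hk, hk'⟩ := Finset.not_subset.1 h2
        exact absurd (htop k hk i hi') (not_le.2 (hsep i hi k hk'))
      subst hΛ
      funext k
      by_cases hk : k ∈ Λ'
      · rw [hz ⟨k, hk⟩, hs, hQ.mulVec_mulVec hB]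
      · rw [hz0 k hk, hx k hk]
    · rintro rfl
      refine ⟨Λ, rfl, fun i hi k hk => (hsep i hi k hk).le, _, isPseudoInverse_of_injective hB,
        fun k => ?_, hx⟩
      rw [hs, (isPseudoInverse_of_injective hB).mulVec_mulVec hB]
  exact ⟨key, fun z hz => by rw [(key z).1 hz]⟩

end Recovery

/-! ### The exceptional set -/

section Constants

lemma lt_C₃ : 17.7 < C₃ := by
  have he := Real.exp_one_gt_d9
  have hpi := Real.pi_lt_d4
  have hpi0 := Real.pi_pos
  have h2 : (1.4142 : ℝ) ≤ √2 := Real.le_sqrt_of_sq_le (by norm_num)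
  have h6 : √(6 * Real.pi) ≤ 4.3417 := by
    rw [Real.sqrt_le_left (by norm_num)]
    nlinarith
  have h60 : 0 < √(6 * Real.pi) := Real.sqrt_pos.2 (by positivity)
  have h1 : 2.504 ≤ C₁ := by
    unfold C₁
    rw [le_div_iff₀ h60]
    nlinarith
  have h3 : 3.844 ≤ C₂ := by
    unfold C₂
    nlinarith
  unfold C₃
  linarith

lemma C₃_le : C₃ ≤ 17.71 := by
  have he := Real.exp_one_lt_d9
  have he0 := Real.exp_pos 1
  have hpi := Real.pi_gt_d4
  have h2 : √2 ≤ 1.41422 := by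
    rw [Real.sqrt_le_left (by norm_num)]
    norm_num
  have h6 : 4.3415 ≤ √(6 * Real.pi) := Real.le_sqrt_of_sq_le (by nlinarith)
  have h60 : 0 < √(6 * Real.pi) := by linarith
  have h1 : C₁ ≤ 2.5046 := by
    unfold C₁
    rw [div_le_iff₀ h60]
    nlinarith
  have h3 : C₂ ≤ 3.8444 := by
    unfold C₂
    have : 0 ≤ √2 := Real.sqrt_nonneg 2
    nlinarith
  unfold C₃
  linarith

/-- The bound of `measure_kernelMeets_le` for the span of `S` atoms. -/
lemma rank_estimate {n S : ℕ} {L : ℝ} (hS : 1 ≤ S) (hL : Real.log 2 ≤ L)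
    (hn : 17.7 * S * L ≤ n) : (3 : ℝ) ^ S * (7 / 9) ^ n ≤ Real.exp (-L) := by
  have hS' : (1 : ℝ) ≤ S := by exact_mod_cast hS
  have hL' : 0.69 < L := by
    have := Real.log_two_gt_d9
    linarith
  have h3 : (3 : ℝ) ≤ Real.exp 1.2 := by
    have h1 := Real.exp_one_gt_d9
    have h2 := Real.add_one_le_exp (0.2 : ℝ)
    rw [show (1.2 : ℝ) = 1 + 0.2 by norm_num, Real.exp_add]
    nlinarith
  have h7 : (7 / 9 : ℝ) ≤ Real.exp (-(2 / 9)) := by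
    have := Real.add_one_le_exp (-(2 / 9) : ℝ)
    linarith
  calc (3 : ℝ) ^ S * (7 / 9) ^ n ≤ Real.exp 1.2 ^ S * Real.exp (-(2 / 9)) ^ n := by gcongr
    _ = Real.exp (S * 1.2 + n * (-(2 / 9))) := by
        rw [← Real.exp_nat_mul, ← Real.exp_nat_mul, ← Real.exp_add]
    _ ≤ Real.exp (-L) := by
        apply Real.exp_le_exp.2
        nlinarith [mul_nonneg (sub_nonneg.2 hS') (sub_nonneg.2 hL'.le)]

lemma exp_neg_pow_le {n : ℕ} {ρ c L : ℝ} (hρ : 0 < ρ)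
    (h : c * L * (1 + ρ) ≤ 0.339 * (n * ρ ^ 2)) :
    Real.exp (-(0.339 * ρ ^ 2 / (1 + ρ))) ^ n ≤ Real.exp (-(c * L)) := by
  rw [← Real.exp_nat_mul]
  apply Real.exp_le_exp.2
  rw [mul_neg, neg_le_neg_iff, mul_div_assoc', le_div_iff₀ (by linarith)]
  linarith

lemma comparison_estimate_one {n : ℕ} {g L : ℝ} (hg0 : 0 < g) (hg1 : g ≤ 1) (hL : 0 < L)
    (hn : 17.7 * L ≤ n * g ^ 2) :
    Real.exp (-(0.339 * (g / 2) ^ 2 / (1 + g / 2))) ^ n ≤ Real.exp (-L) := by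
  have h : Real.exp (-(0.339 * (g / 2) ^ 2 / (1 + g / 2))) ^ n ≤ Real.exp (-(1 * L)) := by
    refine exp_neg_pow_le (by positivity) ?_
    have := mul_le_mul_of_nonneg_left hg1 hL.le
    linarith
  rwa [one_mul] at h

lemma two_mul_le_of_sq_mul_eq {S m g ρ : ℝ} (hS : 2 ≤ S) (hm : 0 ≤ m) (hρ0 : 0 < ρ)
    (hg0 : 0 < g) (hρ : ρ ^ 2 * (2 * S * (1 + m) ^ 2) = g ^ 2) : 2 * (1 + m) * ρ ≤ g := by
  refine (sq_le_sq₀ (by positivity) hg0.le).1 ?_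
  rw [← hρ]
  have := mul_le_mul_of_nonneg_left hS (by positivity : 0 ≤ 2 * (ρ ^ 2 * (1 + m) ^ 2))
  linarith

/-- For at least two atoms in the support the exponent of a comparison is `2 L`, which compensates
for the larger number of comparisons. The constants fit because `6 ≤ 0.339 * 17.7`. -/
lemma comparison_estimate {n : ℕ} {S m g L ρ : ℝ} (hS : 2 ≤ S) (hm : 0 ≤ m) (hρ0 : 0 < ρ)
    (hg0 : 0 < g) (hL : 0 < L) (hg : g ≤ 1 - 2 * m)
    (hρ : ρ ^ 2 * (2 * S * (1 + m) ^ 2) = g ^ 2)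
    (hn : 17.7 * (S * (1 + m) * L) ≤ n * g ^ 2) :
    Real.exp (-(0.339 * ρ ^ 2 / (1 + ρ))) ^ n ≤ Real.exp (-(2 * L)) := by
  refine exp_neg_pow_le hρ0 ?_
  -- `g ≤ 1 - 2 m` gives `(1 + m) (1 + ρ) ≤ 3 / 2`
  have h2 : (1 + m) * (1 + ρ) ≤ 3 / 2 := by
    have := two_mul_le_of_sq_mul_eq hS hm hρ0 hg0 hρ
    linarith
  have h3 : 17.7 * L ≤ n * ρ ^ 2 * (2 * (1 + m)) := by
    rw [← hρ] at hn
    have h4 : (S * (1 + m)) * (17.7 * L) ≤ (S * (1 + m)) * (n * ρ ^ 2 * (2 * (1 + m))) := by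
      linarith
    exact le_of_mul_le_mul_left h4 (by positivity)
  have h5 : (1 + m) * (2 * L * (1 + ρ)) ≤ (1 + m) * (0.339 * (n * ρ ^ 2)) := by
    have := mul_le_mul_of_nonneg_left h2 hL.le
    linarith
  exact le_of_mul_le_mul_left h5 (by positivity)

/-- The sum of the failure probabilities: `2 S (K - S)` comparisons of columns, each failing with
probability `η`, and a loss of rank with probability at most `exp (-L)`, `L = log (2 K) + t`. -/
lemma failure_estimate {S K : ℕ} {t η : ℝ} (hS : 1 ≤ S) (hSK : S ≤ K) (ht : 0 < t)
    (hη0 : 0 ≤ η) (h1 : S < K → η ≤ Real.exp (-(Real.log (2 * K) + t)))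
    (h2 : S < K → S ≠ 1 → η ≤ Real.exp (-(2 * (Real.log (2 * K) + t)))) :
    (S * ((K - S : ℕ) * 2) : ℕ) * η + Real.exp (-(Real.log (2 * K) + t)) ≤ Real.exp (-t) := by
  have hK : (1 : ℝ) ≤ K := by exact_mod_cast hS.trans hSK
  have hS' : (1 : ℝ) ≤ S := by exact_mod_cast hS
  have hSK' : (S : ℝ) ≤ K := by exact_mod_cast hSK
  set E := Real.exp (-t) with hE
  have hE0 : 0 < E := Real.exp_pos _
  have hE1 : E ≤ 1 := by
    rw [hE, Real.exp_le_one_iff]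
    linarith
  have e1 : Real.exp (-(Real.log (2 * K) + t)) = E / (2 * K) := by
    rw [neg_add, Real.exp_add, Real.exp_neg, Real.exp_log (by positivity), ← hE]
    field_simp
  have e2 : Real.exp (-(2 * (Real.log (2 * K) + t))) = (E / (2 * K)) ^ 2 := by
    rw [← e1, ← Real.exp_nat_mul]
    congr 1
    push_cast
    ring
  rw [e1] at h1 ⊢
  rw [e2] at h2
  set δ := E / (2 * K) with hδ
  have hδE : 2 * K * δ = E := by
    rw [hδ]
    field_simp
  have hδ0 : 0 < δ := by positivity
  push_cast [Nat.cast_sub hSK]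
  rcases hSK.eq_or_lt with heq | hlt
  · rw [heq]
    nlinarith
  by_cases hS1 : S = 1
  · have := h1 hlt
    rw [hS1]
    push_cast
    have h0 : 0 ≤ (K : ℝ) - 1 := by linarith
    nlinarith [mul_le_mul_of_nonneg_left this h0]
  · have := h2 hlt hS1
    have h0 : 0 ≤ (S : ℝ) * ((K - S) * 2) := by
      have : 0 ≤ (K : ℝ) - S := by linarith
      positivity
    have h3 : (S : ℝ) * ((K - S) * 2) ≤ K * K := by nlinarith [sq_nonneg ((K : ℝ) - S - S)]
    calc (S : ℝ) * ((K - S) * 2) * η + δ ≤ K * K * δ ^ 2 + δ := by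
          gcongr
      _ ≤ E := by nlinarith

end Constants

section Main

variable {d K n : ℕ} {Ψ : Matrix (Fin d) (Fin K) ℝ} {Λ : Finset (Fin K)} {x : Fin K → ℝ}

/-- The signed difference of atoms whose inner product with `Ψ x` has to stay positive under the
measurements. -/
noncomputable def signedDifference (Ψ : Matrix (Fin d) (Fin K) ℝ) (x : Fin K → ℝ) (i k : Fin K)
    (τ : ℝ) : Fin d → ℝ :=
  (SignType.sign ((Ψ *ᵥ x) ⬝ᵥ atom Ψ i) : ℝ) • atom Ψ i + τ • atom Ψ k

lemma abs_sign_le_one (a : ℝ) : |(SignType.sign a : ℝ)| ≤ 1 := by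
  rcases lt_trichotomy a 0 with h | h | h <;> simp [h]

lemma signedDifference_dotProduct_self_le (hΨ : IsDictionary Ψ) {i k : Fin K} (hik : i ≠ k)
    {τ : ℝ} (hτ : |τ| ≤ 1) :
    signedDifference Ψ x i k τ ⬝ᵥ signedDifference Ψ x i k τ ≤ 2 + 2 * babel Ψ 1 := by
  unfold signedDifference
  set σ : ℝ := (SignType.sign ((Ψ *ᵥ x) ⬝ᵥ atom Ψ i) : ℝ)
  have hσ : |σ| ≤ 1 := abs_sign_le_one _
  simp only [add_dotProduct, dotProduct_add, smul_dotProduct, dotProduct_smul, smul_eq_mul,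
    atom_dotProduct_self hΨ, dotProduct_comm (atom Ψ k) (atom Ψ i)]
  have h1 : σ * τ * (atom Ψ i ⬝ᵥ atom Ψ k) ≤ babel Ψ 1 := by
    refine (le_abs_self _).trans ?_
    rw [abs_mul, abs_mul]
    have := abs_dotProduct_le_babel_one Ψ hik
    calc |σ| * |τ| * |atom Ψ i ⬝ᵥ atom Ψ k| ≤ 1 * 1 * babel Ψ 1 := by gcongr
      _ = babel Ψ 1 := by ring
  have h2 : σ * σ ≤ 1 := by
    rw [← abs_mul_abs_self]
    exact mul_le_one₀ hσ (abs_nonneg _) hσ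
  have h3 : τ * τ ≤ 1 := by
    rw [← abs_mul_abs_self]
    exact mul_le_one₀ hτ (abs_nonneg _) hτ
  nlinarith

lemma le_dotProduct_signedDifference (hΨ : IsDictionary Ψ) (hΛ : Λ.Nonempty)
    (hx : ∀ i ∉ Λ, x i = 0) {i k : Fin K} (hi : i ∈ Λ) (hk : k ∉ Λ) {τ : ℝ} (hτ : |τ| ≤ 1) :
    minAbs Λ hΛ x - ‖x‖ * babel Ψ Λ.card - ‖x‖ * babel Ψ (Λ.card - 1) ≤
      (Ψ *ᵥ x) ⬝ᵥ signedDifference Ψ x i k τ := by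
  unfold signedDifference
  simp only [dotProduct_add, dotProduct_smul, smul_eq_mul, sign_mul_self]
  have h1 := abs_dotProduct_atom_le (Ψ := Ψ) hx hk
  have h2 := abs_dotProduct_atom_sub_le hΨ hx hi
  have h3 : minAbs Λ hΛ x ≤ |x i| := Finset.inf'_le _ hi
  have h4 : |x i| - |(Ψ *ᵥ x) ⬝ᵥ atom Ψ i| ≤ |(Ψ *ᵥ x) ⬝ᵥ atom Ψ i - x i| := by
    rw [abs_sub_comm]
    exact abs_sub_abs_le_abs_sub _ _
  have h5 : |τ * ((Ψ *ᵥ x) ⬝ᵥ atom Ψ k)| ≤ ‖x‖ * babel Ψ Λ.card := by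
    rw [abs_mul]
    refine le_trans ?_ h1
    exact mul_le_of_le_one_left (abs_nonneg _) hτ
  have h6 := neg_abs_le (τ * ((Ψ *ᵥ x) ⬝ᵥ atom Ψ k))
  linarith

/-- The exceptional set of row collections `R`: some comparison of a column in the support with one
outside fails, or the kernel meets the span of the atoms in the support. -/
def exceptionalSet (n : ℕ) (Ψ : Matrix (Fin d) (Fin K) ℝ) (Λ : Finset (Fin K)) (x : Fin K → ℝ) :
    Set (Fin n → Fin d → ℝ) :=
  (⋃ p ∈ Λ ×ˢ (Λᶜ ×ˢ ({1, -1} : Finset ℝ)),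
    {R | ∑ l, (R l ⬝ᵥ (Ψ *ᵥ x)) * (R l ⬝ᵥ signedDifference Ψ x p.1 p.2.1 p.2.2) ≤ 0}) ∪
  kernelMeets n (Submodule.span ℝ (Λ.image (atom Ψ) : Set (Fin d → ℝ)))

lemma mulVec_mem_span (hx : ∀ i ∉ Λ, x i = 0) :
    Ψ *ᵥ x ∈ Submodule.span ℝ (Λ.image (atom Ψ) : Set (Fin d → ℝ)) := by
  have e : Ψ *ᵥ x = ∑ i ∈ Λ, x i • atom Ψ i := by
    rw [Finset.sum_subset (Finset.subset_univ Λ) fun i _ hi => by rw [hx i hi, zero_smul]]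
    ext l
    simp [Matrix.mulVec, dotProduct, atom, mul_comm]
  rw [e]
  refine Submodule.sum_mem _ fun i hi => Submodule.smul_mem _ _ (Submodule.subset_span ?_)
  simpa using ⟨i, hi, rfl⟩

lemma recovers_of_notMem_exceptionalSet (hΨ : IsDictionary Ψ) (hx : ∀ i ∉ Λ, x i = 0)
    (hm : babel Ψ (Λ.card - 1) < 1) {A : Matrix (Fin n) (Fin d) ℝ} {c : ℝ}
    (hA : (fun i j => c * A i j) ∉ exceptionalSet n Ψ Λ x) :
    Recovers A Ψ Λ.card x := by
  have hrow : ∀ (l : Fin n) (v : Fin d → ℝ), (fun j => c * A l j) ⬝ᵥ v = c * (A *ᵥ v) l := by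
    intro l v
    simp only [Matrix.mulVec, dotProduct, Finset.mul_sum, mul_assoc]
  simp only [exceptionalSet, Set.mem_union, Set.mem_iUnion, not_or, not_exists] at hA
  obtain ⟨hpair, hker⟩ := hA
  refine recovers_of_separated hx (fun z hz h => ?_) fun i hi k hk => ?_
  · refine eq_zero_of_mulVec_eq_zero hΨ hm hz ?_
    by_contra h0
    refine hker ⟨Ψ *ᵥ z, mulVec_mem_span hz, h0, fun l => ?_⟩
    rw [hrow, Matrix.mulVec_mulVec, h, Pi.zero_apply, mul_zero]
  · set s := A *ᵥ (Ψ *ᵥ x) with hs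
    have hcol : ∀ j, (fun l => (A * Ψ) l j) = A *ᵥ atom Ψ j := by
      intro j
      ext l
      simp [Matrix.mul_apply, Matrix.mulVec, dotProduct, atom]
    have hpos : ∀ τ ∈ ({1, -1} : Finset ℝ),
        0 < (SignType.sign ((Ψ *ᵥ x) ⬝ᵥ atom Ψ i) : ℝ) * (s ⬝ᵥ (A *ᵥ atom Ψ i)) +
          τ * (s ⬝ᵥ (A *ᵥ atom Ψ k)) := by
      intro τ hτ
      have h := hpair (i, k, τ) (by simpa [hi, hk] using hτ)
      rw [Set.mem_ofPred_eq, not_le] at h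
      have e : ∑ l, ((fun j => c * A l j) ⬝ᵥ (Ψ *ᵥ x)) *
          ((fun j => c * A l j) ⬝ᵥ signedDifference Ψ x i k τ) =
          c ^ 2 * (s ⬝ᵥ (A *ᵥ signedDifference Ψ x i k τ)) := by
        simp_rw [hrow]
        rw [dotProduct, Finset.mul_sum]
        exact Finset.sum_congr rfl fun l _ => by ring
      rw [e] at h
      have h' := pos_of_mul_pos_right h (sq_nonneg c)
      simpa only [signedDifference, Matrix.mulVec_add, Matrix.mulVec_smul, dotProduct_add,
        dotProduct_smul, smul_eq_mul] using h'
    have h1 := hpos 1 (by simp)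
    have h2 := hpos (-1) (by simp)
    rw [hcol, hcol]
    have h3 : (SignType.sign ((Ψ *ᵥ x) ⬝ᵥ atom Ψ i) : ℝ) * (s ⬝ᵥ (A *ᵥ atom Ψ i)) ≤
        |s ⬝ᵥ (A *ᵥ atom Ψ i)| := by
      refine (le_abs_self _).trans ?_
      rw [abs_mul]
      exact mul_le_of_le_one_left (abs_nonneg _) (abs_sign_le_one _)
    rw [abs_lt]
    constructor <;> linarith

/-- The exceptional set is small under the hypotheses of the recovery theorem. -/
lemma measure_exceptionalSet_le {ν : Measure ℝ} [IsProbabilityMeasure ν]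
    (hν : HasDominatedMoments ν) (hΨ : IsDictionary Ψ) (hΛ : Λ.Nonempty)
    (hx : ∀ i ∉ Λ, x i = 0) {t g : ℝ} (ht : 0 < t)
    (hg : g = minAbs Λ hΛ x / ‖x‖ - babel Ψ Λ.card - babel Ψ (Λ.card - 1)) (hg0 : 0 < g)
    (hn : C₃ * Λ.card * (1 + babel Ψ (Λ.card - 1)) * (Real.log (2 * K) + t) * (g ^ 2)⁻¹ ≤ n) :
    (Measure.pi fun _ : Fin n => Measure.pi fun _ : Fin d => ν) (exceptionalSet n Ψ Λ x) ≤
      ENNReal.ofReal (Real.exp (-t)) := by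
  set S := Λ.card with hSdef
  set m := babel Ψ (S - 1) with hm
  set b := babel Ψ S with hb
  set L := Real.log (2 * K) + t with hLdef
  have hS : 1 ≤ S := hΛ.card_pos
  have hSK : S ≤ K := by simpa using Finset.card_le_univ Λ
  have hS' : (1 : ℝ) ≤ S := by exact_mod_cast hS
  have hK' : (1 : ℝ) ≤ K := by exact_mod_cast hS.trans hSK
  have hm0 : 0 ≤ m := babel_nonneg _ _
  have hb0 : 0 ≤ b := babel_nonneg _ _
  have hL : Real.log 2 ≤ L := by
    have := Real.log_le_log two_pos (by linarith : (2 : ℝ) ≤ 2 * K)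
    linarith
  have hL0 : 0 < L := (Real.log_pos one_lt_two).trans_le hL
  have hX : 0 < ‖x‖ := by
    refine lt_of_le_of_ne (norm_nonneg x) fun h => ?_
    rw [← h, div_zero] at hg
    linarith
  have hmin : minAbs Λ hΛ x ≤ ‖x‖ := by
    obtain ⟨i, hi⟩ := hΛ
    exact (Finset.inf'_le (fun i => |x i|) hi).trans (norm_le_pi_norm x i)
  have hgle : g ≤ 1 - b - m := by
    have := (div_le_one hX).2 hmin
    linarith
  have hC := lt_C₃
  -- the lower bound for the number of rows, with the denominator cleared
  have hn' : 17.7 * (S * (1 + m) * L) ≤ n * g ^ 2 := by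
    rw [← div_eq_mul_inv, div_le_iff₀ (by positivity)] at hn
    have : 0 ≤ S * (1 + m) * L := by positivity
    nlinarith
  have hn1 : 17.7 * S * L ≤ n := by
    have h1 : g ^ 2 ≤ 1 := by nlinarith
    have h2 : (n : ℝ) * g ^ 2 ≤ n := mul_le_of_le_one_right (by positivity) h1
    have h3 : (S : ℝ) * L ≤ S * (1 + m) * L := by
      have : 0 ≤ S * m * L := by positivity
      nlinarith
    linarith
  set N := ‖x‖ * √(S * (1 + m)) with hN
  have hN0 : 0 < N := by positivity
  have hNsq : N ^ 2 = ‖x‖ ^ 2 * (S * (1 + m)) := by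
    rw [hN, mul_pow, Real.sq_sqrt (by positivity)]
  have hq : ‖x‖ * g = minAbs Λ hΛ x - ‖x‖ * b - ‖x‖ * m := by
    rw [hg]
    field_simp
  -- the bound for the norm of the signed differences of atoms
  set B := if S = 1 then 2 else √(2 * (1 + m)) with hB
  have hB0 : 0 < B := by
    rw [hB]
    split_ifs <;> positivity
  set ρ := ‖x‖ * g / (N * B) with hρ
  have hρ0 : 0 < ρ := by positivity
  have hρe : ρ = g / (√(S * (1 + m)) * B) := by
    rw [hρ, hN]
    field_simp
  have hBsq : S < K → 2 + 2 * babel Ψ 1 ≤ B ^ 2 := by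
    intro hlt
    rw [hB]
    split_ifs with h1
    · have : babel Ψ 1 = b := by rw [hb, h1]
      nlinarith
    · rw [Real.sq_sqrt (by positivity)]
      have : babel Ψ 1 ≤ m := babel_mono (by omega) (by omega)
      linarith
  -- estimates of `ρ` for `S = 1` and for `S ≥ 2`
  have hρ1 : S = 1 → ρ = g / 2 := by
    intro h1
    have : m = 0 := by rw [hm, h1]; exact babel_zero Ψ
    rw [hρe, hB, if_pos h1, h1, this]
    simp
  have hρ2 : S ≠ 1 → ρ ^ 2 * (2 * S * (1 + m) ^ 2) = g ^ 2 := by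
    intro h1
    rw [hρe, hB, if_neg h1, div_pow, mul_pow, Real.sq_sqrt (by positivity),
      Real.sq_sqrt (by positivity)]
    field_simp
  have hρhalf : ρ ≤ 1 / 2 := by
    by_cases h1 : S = 1
    · rw [hρ1 h1]
      linarith
    · have h2 : (2 : ℝ) ≤ S := by exact_mod_cast (by omega : 2 ≤ S)
      have h3 := two_mul_le_of_sq_mul_eq h2 hm0 hρ0 hg0 (hρ2 h1)
      have : 0 ≤ m * ρ := by positivity
      linarith
  set η := Real.exp (-(0.339 * ρ ^ 2 / (1 + ρ))) ^ n with hη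
  have hη2 : S < K → S ≠ 1 → η ≤ Real.exp (-(2 * L)) := by
    intro hlt h1
    have h2 : (2 : ℝ) ≤ S := by exact_mod_cast (by omega : 2 ≤ S)
    have hmb : m ≤ b := babel_mono (by omega) hlt
    exact comparison_estimate h2 hm0 hρ0 hg0 hL0 (by linarith) (hρ2 h1) hn'
  have hη1 : S < K → η ≤ Real.exp (-L) := by
    intro hlt
    by_cases h1 : S = 1
    · have h2 : 17.7 * L ≤ n * g ^ 2 := by
        rw [h1, Nat.cast_one] at hn'
        have h4 : 0 ≤ m * L := by positivity
        linarith
      rw [hη, hρ1 h1]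
      exact comparison_estimate_one hg0 (by linarith) hL0 h2
    · exact (hη2 hlt h1).trans (Real.exp_le_exp.2 (by linarith))
  have hη0 : 0 ≤ η := by positivity
  have hrank := rank_estimate hS hL hn1
  have hfail := failure_estimate hS hSK ht hη0 hη1 hη2
  refine le_trans ?_ (ENNReal.ofReal_le_ofReal hfail)
  rw [ENNReal.ofReal_add (by positivity) (by positivity)]
  refine (measure_union_le _ _).trans (add_le_add ?_ ?_)
  · refine (measure_biUnion_finset_le _ _).trans ?_
    have hcard : (Λ ×ˢ (Λᶜ ×ˢ ({1, -1} : Finset ℝ))).card = S * ((K - S) * 2) := by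
      rw [Finset.card_product, Finset.card_product, Finset.card_compl, Fintype.card_fin,
        Finset.card_pair (by norm_num)]
    have hterm : ∀ p ∈ Λ ×ˢ (Λᶜ ×ˢ ({1, -1} : Finset ℝ)),
        (Measure.pi fun _ : Fin n => Measure.pi fun _ : Fin d => ν)
          {R | ∑ l, (R l ⬝ᵥ (Ψ *ᵥ x)) * (R l ⬝ᵥ signedDifference Ψ x p.1 p.2.1 p.2.2) ≤ 0} ≤
        ENNReal.ofReal η := by
      rintro ⟨i, k, τ⟩ hp
      simp only [Finset.mem_product, Finset.mem_compl, Finset.mem_insert,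
        Finset.mem_singleton] at hp
      obtain ⟨hi, hk, hτ⟩ := hp
      have hτ1 : |τ| ≤ 1 := by rcases hτ with rfl | rfl <;> simp
      have hlt : S < K := by
        have := Finset.card_lt_univ_of_notMem hk
        simpa using this
      refine measure_sum_mul_nonpos_le hν hN0 hB0 (by positivity) ?_ ?_ ?_ hρhalf
      · rw [hNsq]
        exact mulVec_dotProduct_self_le hΨ hx
      · exact (signedDifference_dotProduct_self_le hΨ (ne_of_mem_of_not_mem hi hk) hτ1).trans
          (hBsq hlt)
      · rw [hq]
        exact le_dotProduct_signedDifference hΨ hΛ hx hi hk hτ1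
    refine (Finset.sum_le_sum hterm).trans (le_of_eq ?_)
    rw [Finset.sum_const, hcard, nsmul_eq_mul, ENNReal.ofReal_mul (by positivity),
      ENNReal.ofReal_natCast]
  · refine (measure_kernelMeets_le hν n _).trans (ENNReal.ofReal_le_ofReal (le_trans ?_ hrank))
    have h1 := (finrank_span_finset_le_card (R := ℝ) (Λ.image (atom Ψ))).trans
      Finset.card_image_le
    gcongr
    · norm_num
    · exact h1

end Main

/-! ### The recovery theorem -/

/-- Recovery for a general dictionary. For `t ≤ 0` the bound is trivial; for `t > 0` the rows of
`√n A` avoid the exceptional set with the required probability. -/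
lemma prob_recovers_ge {d K n : ℕ} {Ψ : Matrix (Fin d) (Fin K) ℝ} (hΨ : IsDictionary Ψ)
    {Λ : Finset (Fin K)} (hΛ : Λ.Nonempty) {x : Fin K → ℝ} (hx : ∀ i ∉ Λ, x i = 0)
    {Ω : Type*} [MeasurableSpace Ω] {P : Measure Ω} [IsProbabilityMeasure P]
    {A : Ω → Matrix (Fin n) (Fin d) ℝ}
    (hA : IsGaussianEnsemble P A ∨ IsBernoulliEnsemble P A) {t : ℝ}
    (hgap : minAbs Λ hΛ x / ‖x‖ > babel Ψ Λ.card + babel Ψ (Λ.card - 1))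
    (hn : (n : ℝ) ≥ C₃ * Λ.card * (1 + babel Ψ (Λ.card - 1)) * (Real.log (2 * K) + t) *
        ((minAbs Λ hΛ x / ‖x‖ - babel Ψ Λ.card - babel Ψ (Λ.card - 1)) ^ 2)⁻¹) :
    P.real {ω | Recovers (A ω) Ψ Λ.card x} ≥ 1 - Real.exp (-t) := by
  rcases le_or_gt t 0 with ht | ht
  · have h1 : 1 ≤ Real.exp (-t) := Real.one_le_exp (by linarith)
    have h2 : 0 ≤ P.real {ω | Recovers (A ω) Ψ Λ.card x} := measureReal_nonneg
    linarith
  have hm0 := babel_nonneg Ψ (Λ.card - 1)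
  have hb0 := babel_nonneg Ψ Λ.card
  have hg0 : 0 < minAbs Λ hΛ x / ‖x‖ - babel Ψ Λ.card - babel Ψ (Λ.card - 1) := by linarith
  have hcard : (0 : ℝ) < Λ.card := by exact_mod_cast hΛ.card_pos
  have hK : (1 : ℝ) ≤ K := by
    exact_mod_cast hΛ.card_pos.trans_le (by simpa using Finset.card_le_univ Λ)
  have hlog : 0 < Real.log (2 * K) := Real.log_pos (by linarith)
  have hn0 : n ≠ 0 := by
    have hC : 0 < C₃ := by
      have := lt_C₃
      linarith
    have : (0 : ℝ) < n := lt_of_lt_of_le (by positivity) hn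
    exact_mod_cast this.ne'
  have hm1 : babel Ψ (Λ.card - 1) < 1 := by
    have hmin : minAbs Λ hΛ x ≤ ‖x‖ := by
      obtain ⟨i, hi⟩ := hΛ
      exact (Finset.inf'_le (fun i => |x i|) hi).trans (norm_le_pi_norm x i)
    have := div_le_one_of_le₀ hmin (norm_nonneg x)
    linarith
  obtain ⟨ν, hνp, hν, hlaw⟩ := exists_hasLaw_rows hn0 hA
  have hbad : P ((fun ω i j => √n * A ω i j) ⁻¹' exceptionalSet n Ψ Λ x) ≤
      ENNReal.ofReal (Real.exp (-t)) := by
    refine (Measure.le_map_apply hlaw.aemeasurable _).trans ?_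
    rw [hlaw.map_eq]
    exact measure_exceptionalSet_le hν hΨ hΛ hx ht rfl hg0 hn
  set E := (fun ω i j => √n * A ω i j) ⁻¹' exceptionalSet n Ψ Λ x with hE
  have hcover : (Set.univ : Set Ω) ⊆ {ω | Recovers (A ω) Ψ Λ.card x} ∪ E := by
    intro ω _
    by_cases h : ω ∈ E
    · exact Or.inr h
    · exact Or.inl (recovers_of_notMem_exceptionalSet hΨ hx hm1 h)
  have h1 : 1 ≤ P.real {ω | Recovers (A ω) Ψ Λ.card x} + P.real E := by
    rw [← probReal_univ (μ := P)]
    exact (measureReal_mono hcover).trans (measureReal_union_le _ _)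
  have h2 : P.real E ≤ Real.exp (-t) :=
    ENNReal.toReal_le_of_le_ofReal (Real.exp_pos _).le hbad
  linarith

lemma babel_eq_zero_of_isOrthonormalBasis {d K : ℕ} {Ψ : Matrix (Fin d) (Fin K) ℝ}
    (hΨ : IsOrthonormalBasis Ψ) (k : ℕ) : babel Ψ k = 0 := by
  refine le_antisymm (babel_le le_rfl fun Λ j _ hj => ?_) (babel_nonneg _ _)
  refine (Finset.sum_eq_zero fun i hi => ?_).le
  have h : (Ψᵀ * Ψ) i j = (1 : Matrix (Fin K) (Fin K) ℝ) i j := by rw [hΨ.1]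
  rw [Matrix.one_apply_ne (ne_of_mem_of_not_mem hi hj)] at h
  rw [abs_eq_zero, ← h]
  rfl

end Thresholding

theorem mainTheorem4 {d K n : ℕ} (Ψ : Matrix (Fin d) (Fin K) ℝ) (hΨ : Thresholding.IsDictionary Ψ)
    (Λ : Finset (Fin K)) (hΛ : Λ.Nonempty) (x : Fin K → ℝ) (hx : ∀ i ∉ Λ, x i = 0)
    {Ω : Type*} [MeasurableSpace Ω] (P : Measure Ω) [IsProbabilityMeasure P]
    (A : Ω → Matrix (Fin n) (Fin d) ℝ)
    (hA : Thresholding.IsGaussianEnsemble P A ∨ Thresholding.IsBernoulliEnsemble P A) (t : ℝ) :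
    Thresholding.C₃ ≤ 17.71 ∧
    -- general dictionary
    (Thresholding.minAbs Λ hΛ x / ‖x‖ >
        Thresholding.babel Ψ Λ.card + Thresholding.babel Ψ (Λ.card - 1) →
      (n : ℝ) ≥ Thresholding.C₃ * Λ.card * (1 + Thresholding.babel Ψ (Λ.card - 1)) *
        (Real.log (2 * K) + t) *
        ((Thresholding.minAbs Λ hΛ x / ‖x‖ - Thresholding.babel Ψ Λ.card
          - Thresholding.babel Ψ (Λ.card - 1)) ^ 2)⁻¹ →
      P.real {ω | Thresholding.Recovers (A ω) Ψ Λ.card x} ≥ 1 - Real.exp (-t)) ∧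
    -- orthonormal basis
    (Thresholding.IsOrthonormalBasis Ψ → (∀ i ∈ Λ, x i ≠ 0) →
      Thresholding.minAbs Λ hΛ x / ‖x‖ >
        Thresholding.babel Ψ Λ.card + Thresholding.babel Ψ (Λ.card - 1) ∧
      ((n : ℝ) > Thresholding.C₃ * Λ.card * (‖x‖ / Thresholding.minAbs Λ hΛ x) ^ 2 *
          (Real.log (2 * K) + t) →
        P.real {ω | Thresholding.Recovers (A ω) Ψ Λ.card x} ≥ 1 - Real.exp (-t))) := by
  refine ⟨Thresholding.C₃_le, Thresholding.prob_recovers_ge hΨ hΛ hx hA, fun hO hx0 => ?_⟩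
  have hb := Thresholding.babel_eq_zero_of_isOrthonormalBasis hO
  have hmin : 0 < Thresholding.minAbs Λ hΛ x :=
    (Finset.lt_inf'_iff hΛ).2 fun i hi => abs_pos.2 (hx0 i hi)
  have hX : 0 < ‖x‖ := by
    obtain ⟨i, hi⟩ := hΛ
    exact norm_pos_iff.2 fun h => hx0 i hi (by rw [h, Pi.zero_apply])
  have hgap : Thresholding.minAbs Λ hΛ x / ‖x‖ >
      Thresholding.babel Ψ Λ.card + Thresholding.babel Ψ (Λ.card - 1) := by
    rw [hb, hb, add_zero]
    positivity
  refine ⟨hgap, fun hn => Thresholding.prob_recovers_ge hΨ hΛ hx hA hgap (hn.le.trans' ?_)⟩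
  rw [hb, hb, sub_zero, sub_zero, add_zero, mul_one, ← inv_pow, inv_div]
  exact le_of_eq (by ring)
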